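/- Let $R$ be a commutative noetherian ring and let $F$ be a faithfully flat $R$-module. Complexes of $R$-modules may be unbounded and are indexed cohomologically. A complex $I$ of $R$-modules is called semi-injective if each module $I^i$ is injective and every morphism from an acyclic complex to $I$ is null-homotopic. For a complex $M$ of $R$-modules, $\operatorname{inj\,dim}_R M \in \mathbb{Z}\cup\{-\infty,\infty\}$ is the infimum of the integers $n$ for which there is a quasi-isomorphism $M \to I$ with $I$ semi-injective and $I^i = 0$ for all $i > n$. Finally, $\operatorname{\mathbf{R}Hom}_R(F,M)$ denotes the complex $\operatorname{Hom}_R(P,M)$, where $P$ is a projective resolution of $F$. (1) For every complex $M$ of $R$-modules, $$\operatorname{inj\,dim}_R \operatorname{\mathbf{R}Hom}_R(F,M) = \operatorname{inj\,dim}_R M.$$ (2) A complex $M$ of $R$-modules is acyclic if and only if $\operatorname{\mathbf{R}Hom}_R(F,M)$ is acyclic. (3) If $M$ is an $R$-module with $\operatorname{Ext}^i_R(F,M)=0$ for all $i>0$, then $\operatorname{Hom}_R(F,M)$ is an injective $R$-module if and only if $M$ is an injective $R$-module. -/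

import Mathlib

open CategoryTheory

universe u

/-- A complex `I` of `R`-modules is semi-injective (also called DG-injective): every module `I.X i`
is injective, and every morphism from an acyclic complex to `I` is null-homotopic. -/
structure IsSemiInjective {R : Type u} [CommRing R] (I : CochainComplex (ModuleCat.{u} R) ℤ) :
    Prop where
  injective : ∀ i : ℤ, Injective (I.X i)
  isKInjective : I.IsKInjective

/-- `inj dim_R M ≤ n`: the complex `M` has a semi-injective resolution `M ⟶ I`
(a quasi-isomorphism) with `I.X i = 0` for all `i > n`. -/
def InjDimLE {R : Type u} [CommRing R] (M : CochainComplex (ModuleCat.{u} R) ℤ) (n : ℤ) : Prop :=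
  ∃ (I : CochainComplex (ModuleCat.{u} R) ℤ) (f : M ⟶ I),
    IsSemiInjective I ∧ QuasiIso f ∧ I.IsStrictlyLE n

/-- The injective dimension of a complex of `R`-modules, the infimum in `ℤ ∪ {-∞, ∞}` of the
integers `n` with `inj dim_R M ≤ n`; it is `⊤` if there is no such `n`, and `⊥` if every integer
is such an `n`. -/
noncomputable def injDim {R : Type u} [CommRing R] (M : CochainComplex (ModuleCat.{u} R) ℤ) :
    WithBot (WithTop ℤ) :=
  sInf {d : WithBot (WithTop ℤ) |
    ∃ n : ℤ, InjDimLE M n ∧ d = ((n : WithTop ℤ) : WithBot (WithTop ℤ))}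

/-- The complex of `R`-modules `Hom_R(P, M)` of two complexes of `R`-modules: in degree `n` it is
the module of all families of linear maps `P.X p ⟶ M.X (p + n)`, and the differential sends `f` of
degree `n` to `d_M ∘ f - (-1) ^ n f ∘ d_P`. -/
noncomputable def homComplex {R : Type u} [CommRing R] (P M : CochainComplex (ModuleCat.{u} R) ℤ) :
    CochainComplex (ModuleCat.{u} R) ℤ where
  X n := ModuleCat.of R (CochainComplex.HomComplex.Cochain P M n)
  d n m := ModuleCat.ofHom (CochainComplex.HomComplex.δ_hom R P M n m)
  shape n m h := by
    refine ModuleCat.hom_ext (LinearMap.ext fun z => ?_)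
    exact CochainComplex.HomComplex.δ_shape n m h z
  d_comp_d' n m k _ _ := by
    refine ModuleCat.hom_ext (LinearMap.ext fun z => ?_)
    exact CochainComplex.HomComplex.δ_δ n m k z

/-- `RHom_R(F, M)` for an `R`-module `F` and an `R`-complex `M`: the complex `Hom_R(P, M)`, where
`P` is a projective resolution of `F`, regarded as a complex in nonpositive degrees. -/
noncomputable def rHom (R : Type u) [CommRing R] (F : Type u) [AddCommGroup F] [Module R F]
    (M : CochainComplex (ModuleCat.{u} R) ℤ) : CochainComplex (ModuleCat.{u} R) ℤ :=
  homComplex (projectiveResolution (ModuleCat.of R F)).cochainComplex M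

/-! ### Cocycle and coboundary criteria for exactness and quasi-isomorphisms. -/

section ElementCriteria

variable {R : Type u} [CommRing R]

/-! Let M → I be a semi-injective resolution and P → F a projective one. The maps Hom(P, M) → Hom(P,
I) ← Hom(F, I) are quasi-isomorphisms, and Hom(F, I) is semi-injective, since Hom(A, Hom(F, I)) =
Hom(A ⊗ F, I) and F is flat. Hence Hom(F, I) resolves RHom(F, M), and any upper bound on I is one on
Hom(F, I).

For the converse, the bound n is detected by modules: M has injective dimension at most n if and
only if, for every module N, the cocycles of Hom(N, I) in degrees above n are coboundaries
(`LiftsAbove`; see `injDimLE_of_liftsAbove` and `liftsAbove_of_injDimLE`). If RHom(F, M) has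
dimension at most n, this holds for Hom(F, I), so by adjunction it holds for I and all modules N ⊗
F. For a prime p, the k(p)-vector space k(p) ⊗ F is nonzero by faithful flatness, so k(p) is a
direct summand of it and inherits the property. Noetherian induction on p along R/p ⊆ k(p) passes to
R/p, and a Zorn argument in the style of Baer's criterion passes to every module
(`LiftsAbove.of_tensorProduct`).

Thus the same integers bound both dimensions, which is (1). Acyclic complexes are those bounded by
every integer, which gives (2). For (3), vanishing of Ext makes Hom(F, I) a resolution of Hom(F, M)
when I is an injective resolution of the module M, and the same descent splits M off I⁰.

Semi-injective resolutions of unbounded complexes are built as limits of towers of bounded below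
complexes of injectives. -/

lemma exactAt_iff_forall_exists {K : CochainComplex (ModuleCat.{u} R) ℤ} {i j k : ℤ}
    (hij : i + 1 = j) (hjk : j + 1 = k) :
    K.ExactAt j ↔ ∀ x : K.X j, K.d j k x = 0 → ∃ y : K.X i, K.d i j y = x := by
  rw [K.exactAt_iff' i j k (by simp; lia) (by simp; lia), ShortComplex.moduleCat_exact_iff]
  rfl

/-- The two clauses are injectivity and surjectivity of the induced map between the concrete
homologies ker g / im f. -/
lemma ShortComplex.moduleCat_quasiIso_iff {S T : ShortComplex (ModuleCat.{u} R)} (φ : S ⟶ T) :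
    ShortComplex.QuasiIso φ ↔
      (∀ x : S.X₂, S.g x = 0 → (∃ y : T.X₁, T.f y = φ.τ₂ x) → ∃ w : S.X₁, S.f w = x) ∧
      (∀ z : T.X₂, T.g z = 0 → ∃ (x : S.X₂) (y : T.X₁), S.g x = 0 ∧ z = φ.τ₂ x + T.f y) := by
  let hS := S.moduleCatLeftHomologyData
  let hT := T.moduleCatLeftHomologyData
  obtain ⟨πS, hS', hπS, hsS⟩ : ∃ πS : LinearMap.ker S.g.hom →ₗ[R] hS.H, hS.π.hom = πS ∧
      (∀ z, πS z = 0 ↔ ∃ w : S.X₁, S.f w = z.1) ∧ Function.Surjective πS := by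
    refine ⟨hS.π.hom, rfl, fun z => (Submodule.Quotient.mk_eq_zero _).trans ?_,
      Submodule.mkQ_surjective _⟩
    simp only [LinearMap.mem_range, Subtype.ext_iff]
    rfl
  obtain ⟨πT, hT', hπT, hsT⟩ : ∃ πT : LinearMap.ker T.g.hom →ₗ[R] hT.H, hT.π.hom = πT ∧
      (∀ z, πT z = 0 ↔ ∃ w : T.X₁, T.f w = z.1) ∧ Function.Surjective πT := by
    refine ⟨hT.π.hom, rfl, fun z => (Submodule.Quotient.mk_eq_zero _).trans ?_,
      Submodule.mkQ_surjective _⟩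
    simp only [LinearMap.mem_range, Subtype.ext_iff]
    rfl
  have hmem : ∀ z : LinearMap.ker S.g.hom, φ.τ₂.hom z.1 ∈ LinearMap.ker T.g.hom := fun z => by
    have h1 := congr($(φ.comm₂₃) z.1)
    have h2 : S.g z.1 = 0 := z.2
    simpa [h2] using h1
  let c : LinearMap.ker S.g.hom → LinearMap.ker T.g.hom := fun z => ⟨φ.τ₂.hom z.1, hmem z⟩
  let H : hS.H →ₗ[R] hT.H := (ShortComplex.leftHomologyMap' φ hS hT).hom
  have hc : ∀ z : LinearMap.ker S.g.hom, H (πS z) = πT (c z) := by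
    intro z
    have h1 := congr($(ShortComplex.leftHomologyπ_naturality' φ hS hT).hom z)
    have h2 : (ShortComplex.cyclesMap' φ hS hT).hom z = c z :=
      Subtype.ext congr($(ShortComplex.cyclesMap'_i φ hS hT) z)
    rw [← h2, ← hS', ← hT']
    exact h1
  rw [ShortComplex.quasiIso_iff_isIso_leftHomologyMap' φ hS hT, ConcreteCategory.isIso_iff_bijective]
  change Function.Bijective H ↔ _
  constructor
  · rintro ⟨hi, hs⟩
    refine ⟨fun x hx hy => ?_, fun z hz => ?_⟩
    · refine (hπS ⟨x, hx⟩).1 (hi ?_)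
      rw [map_zero, hc]
      exact (hπT _).2 hy
    · obtain ⟨z', rfl⟩ : ∃ z' : LinearMap.ker T.g.hom, z'.1 = z := ⟨⟨z, hz⟩, rfl⟩
      obtain ⟨a, ha⟩ := hs (πT z')
      obtain ⟨x, rfl⟩ := hsS a
      rw [hc, eq_comm, ← sub_eq_zero, ← map_sub] at ha
      obtain ⟨y, hy⟩ := (hπT _).1 ha
      refine ⟨x.1, y, x.2, ?_⟩
      rw [hy]
      change z'.1 = φ.τ₂ x.1 + (z'.1 - φ.τ₂ x.1)
      abel
  · rintro ⟨h₁, h₂⟩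
    refine ⟨(injective_iff_map_eq_zero _).2 fun a ha => ?_, fun b => ?_⟩
    · obtain ⟨x, rfl⟩ := hsS a
      rw [hc] at ha
      exact (hπS _).2 (h₁ x.1 x.2 ((hπT _).1 ha))
    · obtain ⟨z, rfl⟩ := hsT b
      obtain ⟨x, y, hx, hz⟩ := h₂ z.1 z.2
      obtain ⟨x', rfl⟩ : ∃ x' : LinearMap.ker S.g.hom, x'.1 = x := ⟨⟨x, hx⟩, rfl⟩
      refine ⟨πS x', ?_⟩
      rw [hc, eq_comm, ← sub_eq_zero, ← map_sub]
      refine (hπT _).2 ⟨y, ?_⟩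
      change T.f y = z.1 - φ.τ₂ x'.1
      rw [hz]; abel

lemma quasiIsoAt_iff_elements {K L : CochainComplex (ModuleCat.{u} R) ℤ} (f : K ⟶ L) {i j k : ℤ}
    (hij : i + 1 = j) (hjk : j + 1 = k) :
    QuasiIsoAt f j ↔
      (∀ x : K.X j, K.d j k x = 0 → (∃ y : L.X i, L.d i j y = f.f j x) →
        ∃ w : K.X i, K.d i j w = x) ∧
      (∀ z : L.X j, L.d j k z = 0 → ∃ (x : K.X j) (y : L.X i), K.d j k x = 0 ∧
        z = f.f j x + L.d i j y) := by
  rw [quasiIsoAt_iff' f i j k (by simp; lia) (by simp; lia), ShortComplex.moduleCat_quasiIso_iff]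
  rfl

lemma quasiIso_iff_elements {K L : CochainComplex (ModuleCat.{u} R) ℤ} (f : K ⟶ L) :
    QuasiIso f ↔ ∀ i j k : ℤ, i + 1 = j → j + 1 = k →
      (∀ x : K.X j, K.d j k x = 0 → (∃ y : L.X i, L.d i j y = f.f j x) →
        ∃ w : K.X i, K.d i j w = x) ∧
      (∀ z : L.X j, L.d j k z = 0 → ∃ (x : K.X j) (y : L.X i), K.d j k x = 0 ∧
        z = f.f j x + L.d i j y) := by
  rw [quasiIso_iff]
  refine ⟨fun h i j k hij hjk => (quasiIsoAt_iff_elements f hij hjk).1 (h j), fun h j => ?_⟩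
  exact (quasiIsoAt_iff_elements f (sub_add_cancel j 1) rfl).2
    (h (j - 1) j (j + 1) (by lia) rfl)

end ElementCriteria

/-! ### Descent of the lifting property from the modules N ⊗ F to all modules. -/

section LiftingCocycles

open TensorProduct

variable {R : Type u} [CommRing R]

/-- A map `f : N → Y` killed by `e : Y → Z` lifts along `d : X → Y`, with `X` injective, as soon as
this is so for the modules `R ⧸ q` with `q` an associated prime of a quotient of `N`. -/
lemma exists_lift_of_forall_quotient_prime [IsNoetherianRing R]
    {X Y Z N : Type u} [AddCommGroup X] [AddCommGroup Y] [AddCommGroup Z] [AddCommGroup N]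
    [Module R X] [Module R Y] [Module R Z] [Module R N] [Module.Injective R X]
    (d : X →ₗ[R] Y) (e : Y →ₗ[R] Z) (hed : ∀ x, e (d x) = 0)
    (h : ∀ (N' : Submodule R N) (q : Ideal R) (u : (R ⧸ q) →ₗ[R] N ⧸ N'), q.IsPrime →
      Function.Injective u → ∀ a : (R ⧸ q) →ₗ[R] Y, e ∘ₗ a = 0 → ∃ b, d ∘ₗ b = a)
    (f : N →ₗ[R] Y) (hf : e ∘ₗ f = 0) : ∃ g, d ∘ₗ g = f := by
  have hf' : ∀ x, e (f x) = 0 := fun x => congr($hf x)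
  -- Partial lifts of f. A maximal one with proper domain is enlarged by an element whose class
  -- modulo the domain has prime annihilator q.
  let s : Set (N →ₗ.[R] X) := {g | ∀ x : g.domain, d (g x) = f x}
  obtain ⟨g, -, hg⟩ := zorn_le_nonempty₀ s (by
    intro c hcs hc y hy
    have hdir : DirectedOn (· ≤ ·) c := hc.directedOn
    refine ⟨LinearPMap.sSup c hdir, ?_, fun z hz => LinearPMap.le_sSup hdir hz⟩
    rintro ⟨x, hx⟩
    obtain ⟨l, hl, hxl⟩ := (LinearPMap.mem_domain_sSup_iff ⟨y, hy⟩ hdir).1 hx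
    rw [LinearPMap.sSup_apply hdir hl ⟨x, hxl⟩]
    exact hcs hl ⟨x, hxl⟩) ⊥ (by
      rintro ⟨x, hx⟩
      have hx' : x = 0 := (Submodule.mem_bot R).1 hx
      subst hx'
      have h0 : (⟨0, hx⟩ : (⊥ : N →ₗ.[R] X).domain) = 0 := rfl
      rw [h0]
      simp)
  obtain ⟨k, hk⟩ := Module.Injective.extension_property R X g.domain N g.domain.subtype
    (Submodule.injective_subtype _) g.toFun
  have hk' : ∀ x : g.domain, k x = g x := fun x => congr($hk x)
  have hgs : ∀ x : g.domain, d (g x) = f x := hg.prop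
  by_cases htop : g.domain = ⊤
  · refine ⟨k, LinearMap.ext fun x => ?_⟩
    have := hgs ⟨x, htop ▸ Submodule.mem_top⟩
    rw [← hk'] at this
    exact this
  exfalso
  have : Nontrivial (N ⧸ g.domain) := Submodule.Quotient.nontrivial_iff.2 htop
  obtain ⟨q, hq⟩ := associatedPrimes.nonempty R (N ⧸ g.domain)
  obtain ⟨hqp, x, hx⟩ := isAssociatedPrime_iff.1 hq
  have hmem : ∀ r, r ∈ q ↔ r • x = 0 := by
    intro r
    rw [hx, Submodule.mem_colon_singleton, Submodule.mem_bot]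
  let u : (R ⧸ q) →ₗ[R] N ⧸ g.domain :=
    q.liftQ (LinearMap.toSpanSingleton R _ x) fun r hr => (hmem r).1 hr
  have hu : Function.Injective u := by
    rw [← LinearMap.ker_eq_bot]
    refine Submodule.ker_liftQ_eq_bot _ _ _ fun r hr => (hmem r).2 hr
  obtain ⟨x', rfl⟩ := Submodule.mkQ_surjective _ x
  have hφ : ∀ m ∈ g.domain, (f - d ∘ₗ k) m = 0 := fun m hm => by
    rw [LinearMap.sub_apply, LinearMap.comp_apply, hk' ⟨m, hm⟩, hgs ⟨m, hm⟩, sub_self]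
  let a : (R ⧸ q) →ₗ[R] Y := g.domain.liftQ (f - d ∘ₗ k) hφ ∘ₗ u
  obtain ⟨b, hb⟩ := h g.domain q u hqp hu a (by
    refine LinearMap.ext fun r => ?_
    obtain ⟨m, hm⟩ := Submodule.mkQ_surjective _ (u r)
    change e (g.domain.liftQ (f - d ∘ₗ k) hφ (u r)) = 0
    rw [← hm]
    change e (f m - d (k m)) = 0
    rw [map_sub, hf', hed, sub_zero])
  obtain ⟨v, hv⟩ := Module.Injective.extension_property R X (R ⧸ q) _ u hu b
  have hv' : ∀ r, v (u r) = b r := fun r => congr($hv r)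
  -- k extends g but lifts f only on the domain of g. The error f - dk factors through the quotient
  -- by that domain, and v corrects it on the copy of R/q there.
  let g₁ : N →ₗ[R] X := k + v ∘ₗ g.domain.mkQ
  let D : Submodule R N := g.domain ⊔ Submodule.span R {x'}
  have hu1 : u (Submodule.Quotient.mk 1) = g.domain.mkQ x' := by
    exact (Submodule.liftQ_apply _ _ _).trans (one_smul R _)
  let G : N →ₗ.[R] X := ⟨D, g₁ ∘ₗ D.subtype⟩
  have hG : G ∈ s := by
    have key : D ≤ LinearMap.ker (d ∘ₗ g₁ - f) := by
      refine sup_le (fun m hm => ?_) ?_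
      · have h0 : g.domain.mkQ m = 0 := (Submodule.Quotient.mk_eq_zero _).2 hm
        have h1 := hφ m hm
        simp only [LinearMap.sub_apply, LinearMap.comp_apply] at h1
        simp only [g₁, LinearMap.mem_ker, LinearMap.sub_apply, LinearMap.comp_apply,
          LinearMap.add_apply, h0, map_zero, add_zero]
        rw [← neg_sub, h1, neg_zero]
      · rw [Submodule.span_singleton_le_iff_mem]
        have h1 : d (b (Submodule.Quotient.mk 1)) = f x' - d (k x') := by
          have := congr($hb (Submodule.Quotient.mk 1))
          rw [LinearMap.comp_apply] at this
          rw [this]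
          change g.domain.liftQ (f - d ∘ₗ k) hφ (u (Submodule.Quotient.mk 1)) = _
          rw [hu1]
          rfl
        simp only [g₁, LinearMap.mem_ker, LinearMap.sub_apply, LinearMap.comp_apply,
          LinearMap.add_apply, ← hu1, hv', map_add, h1]
        abel
    rintro ⟨m, hm⟩
    exact sub_eq_zero.1 (key hm)
  have hgG : g ≤ G := by
    refine ⟨le_sup_left, ?_⟩
    rintro ⟨m, hm⟩ ⟨m', hm'⟩ (rfl : m = m')
    have h0 : g.domain.mkQ m = 0 := (Submodule.Quotient.mk_eq_zero _).2 hm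
    change g ⟨m, hm⟩ = k m + v (g.domain.mkQ m)
    rw [h0, map_zero, add_zero, ← hk' ⟨m, hm⟩]
  have hDg : x' ∈ g.domain :=
    (hg.le_of_ge hG hgG).1 (le_sup_right (a := g.domain) (Submodule.mem_span_singleton_self x'))
  have h0 : g.domain.mkQ x' = 0 := (Submodule.Quotient.mk_eq_zero _).2 hDg
  apply hqp.ne_top
  rw [Ideal.eq_top_iff_one, hmem, h0, smul_zero]

/-- In degrees above `n`, cocycles of the complex `Hom(N, I)` are coboundaries. -/
def LiftsAbove (I : CochainComplex (ModuleCat.{u} R) ℤ) (n : ℤ) (N : Type u) [AddCommGroup N]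
    [Module R N] : Prop :=
  ∀ i, n ≤ i → ∀ f : N →ₗ[R] I.X (i + 1), (I.d (i + 1) (i + 1 + 1)).hom ∘ₗ f = 0 →
    ∃ g : N →ₗ[R] I.X i, (I.d i (i + 1)).hom ∘ₗ g = f

namespace LiftsAbove

variable {I : CochainComplex (ModuleCat.{u} R) ℤ} {n : ℤ} {N : Type u} [AddCommGroup N] [Module R N]

lemma of_retract {N' : Type u} [AddCommGroup N'] [Module R N'] (h : LiftsAbove I n N')
    (s : N →ₗ[R] N') (r : N' →ₗ[R] N) (hrs : r ∘ₗ s = LinearMap.id) : LiftsAbove I n N := by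
  intro i hi f hf
  obtain ⟨g, hg⟩ := h i hi (f ∘ₗ r) (by rw [← LinearMap.comp_assoc, hf, LinearMap.zero_comp])
  exact ⟨g ∘ₗ s, by
    rw [← LinearMap.comp_assoc, hg, LinearMap.comp_assoc, hrs, LinearMap.comp_id]⟩

/-- A piece of the long exact sequence: H^{i+1} of Hom(N, I) lies between H^{i+1} of Hom(N', I) and
H^{i+2} of Hom(N'/N, I). The shift is harmless because the property concerns all degrees above n. -/
lemma of_injective [∀ i, Module.Injective R (I.X i)] {N' : Type u} [AddCommGroup N'] [Module R N']
    (ι : N →ₗ[R] N') (hι : Function.Injective ι) (h : LiftsAbove I n N')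
    (h' : LiftsAbove I n (N' ⧸ LinearMap.range ι)) : LiftsAbove I n N := by
  intro i hi f hf
  obtain ⟨k, hk⟩ := Module.Injective.extension_property R (I.X (i + 1)) N N' ι hι f
  have hdd : (I.d (i + 1 + 1) (i + 1 + 1 + 1)).hom ∘ₗ (I.d (i + 1) (i + 1 + 1)).hom = 0 := by
    rw [← ModuleCat.hom_comp, I.d_comp_d, ModuleCat.hom_zero]
  have hdk : LinearMap.range ι ≤ LinearMap.ker ((I.d (i + 1) (i + 1 + 1)).hom ∘ₗ k) := by
    rintro _ ⟨x, rfl⟩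
    have : k (ι x) = f x := congr($hk x)
    rw [LinearMap.mem_ker, LinearMap.comp_apply, this]
    exact congr($hf x)
  obtain ⟨c, hc⟩ := h' (i + 1) (by lia) ((LinearMap.range ι).liftQ _ hdk) (by
    refine Submodule.linearMap_qext _ ?_
    rw [LinearMap.comp_assoc, Submodule.liftQ_mkQ, ← LinearMap.comp_assoc, hdd,
      LinearMap.zero_comp, LinearMap.zero_comp])
  obtain ⟨g, hg⟩ := h i hi (k - c ∘ₗ (LinearMap.range ι).mkQ) (by
    rw [LinearMap.comp_sub, ← LinearMap.comp_assoc, hc, Submodule.liftQ_mkQ, sub_self])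
  refine ⟨g ∘ₗ ι, ?_⟩
  rw [← LinearMap.comp_assoc, hg, LinearMap.sub_comp, hk, LinearMap.comp_assoc,
    LinearMap.range_mkQ_comp, LinearMap.comp_zero, sub_zero]

lemma of_forall_quotient_prime [IsNoetherianRing R] [∀ i, Module.Injective R (I.X i)]
    (h : ∀ (N' : Submodule R N) (q : Ideal R) (u : (R ⧸ q) →ₗ[R] N ⧸ N'), q.IsPrime →
      Function.Injective u → LiftsAbove I n (R ⧸ q)) : LiftsAbove I n N := by
  intro i hi f hf
  refine exists_lift_of_forall_quotient_prime (I.d i (i + 1)).hom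
    (I.d (i + 1) (i + 1 + 1)).hom (fun x => ?_) (fun N' q u hq hu a ha => h N' q u hq hu i hi a ha)
    f hf
  exact congr($(I.d_comp_d i (i + 1) (i + 1 + 1)).hom x)

/-- Noetherian induction from larger primes. The cokernel of R/p → k(p) is killed by p, and each of
its elements is killed by some denominator outside p; so any R/q embedded in a quotient of it has q
strictly larger than p. -/
lemma quotient_prime [IsNoetherianRing R] [∀ i, Module.Injective R (I.X i)]
    (h : ∀ (p : Ideal R) [p.IsPrime], LiftsAbove I n p.ResidueField) (p : Ideal R) (hp : p.IsPrime) :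
    LiftsAbove I n (R ⧸ p) := by
  induction p using WellFoundedGT.induction with
  | ind p ih =>
  refine of_injective (N' := p.ResidueField) (Algebra.linearMap (R ⧸ p) p.ResidueField |>.restrictScalars R)
    (IsFractionRing.injective (R ⧸ p) p.ResidueField) (h p) ?_
  refine of_forall_quotient_prime fun N' q u hq hu => ih q ?_ hq
  have hmem : ∀ r, r ∈ q ↔ r • u (Submodule.Quotient.mk 1) = 0 := fun r => by
    rw [← map_smul, map_eq_zero_iff u hu, ← Submodule.Quotient.mk_smul, smul_eq_mul, mul_one]
    exact (Submodule.Quotient.mk_eq_zero _).symm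
  obtain ⟨y, hy⟩ := Submodule.mkQ_surjective _ (u (Submodule.Quotient.mk 1))
  obtain ⟨x, rfl⟩ := Submodule.mkQ_surjective _ y
  refine lt_of_le_of_ne (fun r hr => ?_) ?_
  · rw [hmem, ← hy, ← map_smul, ← map_smul, Algebra.smul_def,
      Ideal.algebraMap_residueField_eq_zero.2 hr, zero_mul, map_zero, map_zero]
  -- If q = p, write a representative in k(p) of the generator of R/q as a fraction with denominator
  -- s ∉ p. Multiplying by s lands in R/p, so s annihilates the generator, contradicting s ∉ q.
  · rintro rfl
    obtain ⟨a, s, hs, hx⟩ := IsFractionRing.div_surjective (A := R ⧸ p) x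
    obtain ⟨s, rfl⟩ := Ideal.Quotient.mk_surjective s
    have hs0 : algebraMap (R ⧸ p) p.ResidueField (Ideal.Quotient.mk p s) ≠ 0 :=
      IsFractionRing.to_map_ne_zero_of_mem_nonZeroDivisors hs
    have hsp : s ∉ p := fun hsp => hs0 (by rw [Ideal.Quotient.eq_zero_iff_mem.2 hsp, map_zero])
    refine hsp ((hmem s).2 ?_)
    rw [← hy, ← map_smul, ← map_smul]
    have : s • x = algebraMap (R ⧸ p) p.ResidueField a := by
      rw [← hx, Algebra.smul_def, IsScalarTower.algebraMap_apply R (R ⧸ p) p.ResidueField]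
      exact mul_div_cancel₀ _ hs0
    rw [this]
    have h0 : (LinearMap.range ((Algebra.linearMap (R ⧸ p) p.ResidueField).restrictScalars R)).mkQ
        (algebraMap (R ⧸ p) p.ResidueField a) = 0 :=
      (Submodule.Quotient.mk_eq_zero _).2 ⟨a, rfl⟩
    rw [h0, map_zero]

/-- Faithful flatness makes k(p) ⊗ F a nonzero k(p)-vector space, so the line through any nonzero
vector is a direct summand. -/
lemma residueField_of_tensorProduct (F : Type u) [AddCommGroup F] [Module R F]
    [Module.FaithfullyFlat R F] (p : Ideal R) [p.IsPrime]
    (h : LiftsAbove I n (p.ResidueField ⊗[R] F)) : LiftsAbove I n p.ResidueField := by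
  obtain ⟨v, hv⟩ := exists_ne (0 : p.ResidueField ⊗[R] F)
  let s : p.ResidueField →ₗ[p.ResidueField] p.ResidueField ⊗[R] F :=
    LinearMap.toSpanSingleton _ _ v
  obtain ⟨r, hr⟩ := LinearMap.exists_leftInverse_of_injective s
    (LinearMap.ker_toSpanSingleton _ hv)
  exact h.of_retract (s.restrictScalars R) (r.restrictScalars R)
    (LinearMap.ext fun x => congr($hr x))

theorem of_tensorProduct [IsNoetherianRing R] [∀ i, Module.Injective R (I.X i)] (F : Type u)
    [AddCommGroup F] [Module R F] [Module.FaithfullyFlat R F]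
    (h : ∀ (N : Type u) [AddCommGroup N] [Module R N], LiftsAbove I n (N ⊗[R] F)) :
    LiftsAbove I n N :=
  of_forall_quotient_prime fun _ q _ hq _ =>
    quotient_prime (fun p _ => residueField_of_tensorProduct F p (h _)) q hq

end LiftsAbove

end LiftingCocycles

/-! ### Truncating a semi-injective resolution. -/

section Truncation

variable {R : Type u} [CommRing R]

lemma d_apply_d_apply (K : CochainComplex (ModuleCat.{u} R) ℤ) (i j k : ℤ) (x : K.X i) :
    K.d j k (K.d i j x) = 0 :=
  congr($(K.d_comp_d i j k).hom x)

/-- The complex of submodules of the terms of `K` that is stable under the differential. -/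
noncomputable def subcomplex (K : CochainComplex (ModuleCat.{u} R) ℤ)
    (S : ∀ i, Submodule R (K.X i)) (hS : ∀ i j, ∀ x ∈ S i, (K.d i j).hom x ∈ S j) :
    CochainComplex (ModuleCat.{u} R) ℤ where
  X i := ModuleCat.of R (S i)
  d i j := ModuleCat.ofHom ((K.d i j).hom.restrict (hS i j))
  shape i j h := by
    refine ModuleCat.hom_ext (LinearMap.ext fun x => Subtype.ext ?_)
    exact congr($(K.shape i j h).hom x.1)
  d_comp_d' i j k _ _ := by
    refine ModuleCat.hom_ext (LinearMap.ext fun x => Subtype.ext ?_)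
    exact d_apply_d_apply K i j k x.1

/-- The inclusion of a subcomplex. -/
noncomputable def subcomplexι (K : CochainComplex (ModuleCat.{u} R) ℤ)
    (S : ∀ i, Submodule R (K.X i)) (hS : ∀ i j, ∀ x ∈ S i, (K.d i j).hom x ∈ S j) :
    subcomplex K S hS ⟶ K where
  f i := ModuleCat.ofHom (S i).subtype

lemma isKInjective_of_retract {K L : CochainComplex (ModuleCat.{u} R) ℤ} (s : K ⟶ L) (r : L ⟶ K)
    (h : s ≫ r = 𝟙 K) [L.IsKInjective] : K.IsKInjective where
  nonempty_homotopy_zero {A} φ hA := by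
    obtain ⟨H⟩ := CochainComplex.IsKInjective.nonempty_homotopy_zero (φ ≫ s) hA
    refine ⟨(Homotopy.ofEq ?_).trans ((H.compRight r).trans (Homotopy.ofEq ?_))⟩
    · rw [Category.assoc, h, Category.comp_id]
    · rw [Limits.zero_comp]

/-- The hypothesis for N = ker d^{i+1} and its inclusion into I^{i+1} gives a section of I^i → ker
d^{i+1} for i ≥ n. Hence I is exact above n and its truncation ending in ker d^n is a direct summand
of I, so it is semi-injective too. -/
theorem injDimLE_of_liftsAbove {M I : CochainComplex (ModuleCat.{u} R) ℤ} (f : M ⟶ I)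
    [QuasiIso f] (hI : IsSemiInjective I) (n : ℤ)
    (h : ∀ (N : Type u) [AddCommGroup N] [Module R N], LiftsAbove I n N) : InjDimLE M n := by
  have hs : ∀ i, n ≤ i → ∃ s : LinearMap.ker (I.d (i + 1) (i + 1 + 1)).hom →ₗ[R] I.X i,
      ∀ x, I.d i (i + 1) (s x) = x.1 := by
    intro i hi
    obtain ⟨s, hs⟩ := h _ i hi (LinearMap.ker (I.d (i + 1) (i + 1 + 1)).hom).subtype
      (LinearMap.ext fun x => x.2)
    exact ⟨s, fun x => congr($hs x)⟩
  -- Everything below degree n, the cocycles in degree n, and zero above.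
  let S : ∀ i, Submodule R (I.X i) := fun i =>
    { carrier := {x | (n ≤ i → I.d i (i + 1) x = 0) ∧ (n < i → x = 0)}
      zero_mem' := ⟨fun _ => map_zero _, fun _ => rfl⟩
      add_mem' := fun {a b} ha hb => ⟨fun hi => by rw [map_add, ha.1 hi, hb.1 hi, add_zero],
        fun hi => by rw [ha.2 hi, hb.2 hi, add_zero]⟩
      smul_mem' := fun c x hx => ⟨fun hi => by rw [map_smul, hx.1 hi, smul_zero],
        fun hi => by rw [hx.2 hi, smul_zero]⟩ }
  have hS : ∀ i j, ∀ x ∈ S i, (I.d i j).hom x ∈ S j := by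
    intro i j x hx
    by_cases hij : i + 1 = j
    · subst hij
      exact ⟨fun _ => d_apply_d_apply I _ _ _ x, fun hi => hx.1 (by lia)⟩
    · rw [I.shape i j hij]
      exact zero_mem _
  have htop : ∀ i, i < n → ∀ x, x ∈ S i := fun i hi x => ⟨fun h => by lia, fun h => by lia⟩
  have hr : ∀ i, ∃ r : I.X i →ₗ[R] S i, ∀ x : S i, r x.1 = x := by
    intro i
    rcases lt_trichotomy i n with hi | rfl | hi
    · exact ⟨LinearMap.id.codRestrict _ (fun x => htop i hi x), fun x => rfl⟩
    · obtain ⟨s, hs⟩ := hs i le_rfl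
      have hd : ∀ x, (I.d i (i + 1)).hom x ∈ LinearMap.ker (I.d (i + 1) (i + 1 + 1)).hom :=
        fun x => d_apply_d_apply I _ _ _ x
      -- Since ds is the inclusion of the cocycles, 1 - sd is a projection onto ker d^n.
      refine ⟨(LinearMap.id - s ∘ₗ (I.d i (i + 1)).hom.codRestrict _ hd).codRestrict (S i)
        fun x => ⟨fun _ => ?_, fun h => (lt_irrefl _ h).elim⟩, fun x => Subtype.ext ?_⟩
      · have h0 : (I.d i (i + 1)).hom.codRestrict _ hd x.1 = 0 := Subtype.ext (x.2.1 le_rfl)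
        change x.1 - s ((I.d i (i + 1)).hom.codRestrict _ hd x.1) = x.1
        rw [h0, map_zero, sub_zero]
      · change (I.d i (i + 1)) (x - s ((I.d i (i + 1)).hom.codRestrict _ hd x)) = 0
        rw [map_sub, hs]
        exact sub_self _
    · refine ⟨0, fun x => Subtype.ext ?_⟩
      exact (x.2.2 hi).symm
  choose r hr using hr
  let J := subcomplex I S hS
  have hrx : ∀ i (x : I.X i), x ∈ S i → (r i x).1 = x := fun i x hx => congr($(hr i ⟨x, hx⟩).1)
  have hcomm : ∀ i (x : I.X i), I.d i (i + 1) (r i x).1 = (r (i + 1) (I.d i (i + 1) x)).1 := by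
    intro i x
    by_cases hi : n ≤ i
    · rw [(r i x).2.1 hi, (r (i + 1) _).2.2 (by lia)]
    · rw [hrx i x (htop i (by lia) x), hrx]
      exact ⟨fun _ => d_apply_d_apply I _ _ _ x, fun h => by lia⟩
  let ρ : I ⟶ J :=
    { f := fun i => ModuleCat.ofHom (r i)
      comm' := by
        rintro i _ rfl
        ext x
        exact Subtype.ext (hcomm i x) }
  have hιρ : subcomplexι I S hS ≫ ρ = 𝟙 J := by
    ext i x
    exact hr i x
  have hρ : QuasiIso ρ := by
    rw [quasiIso_iff_elements]
    rintro i _ _ rfl rfl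
    refine ⟨fun x hx hy => ?_, fun z hz => ⟨z.1, 0, ?_, ?_⟩⟩
    · obtain ⟨y, hy⟩ := hy
      by_cases hi : n ≤ i
      · obtain ⟨s, hs⟩ := hs i hi
        exact ⟨s ⟨x, hx⟩, hs _⟩
      · refine ⟨y.1, ?_⟩
        have h1 : I.d i (i + 1) y.1 = (r (i + 1) x).1 := congr($hy.1)
        rw [h1, hrx]
        exact ⟨fun _ => hx, fun h => by lia⟩
    · exact congr($hz.1)
    · rw [map_zero, add_zero]
      exact (hr _ z).symm
  refine ⟨J, f ≫ ρ, ⟨fun i => ?_, ?_⟩, inferInstance, ?_⟩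
  · have := hI.injective i
    exact Retract.injective (Y := I.X i)
      { i := (subcomplexι I S hS).f i
        r := ρ.f i
        retract := congr($(hιρ).f i) }
  · have := hI.isKInjective
    exact isKInjective_of_retract _ ρ hιρ
  · rw [CochainComplex.isStrictlyLE_iff]
    intro i hi
    have : Subsingleton (S i) := ⟨fun a b => Subtype.ext ((a.2.2 hi).trans (b.2.2 hi).symm)⟩
    exact ModuleCat.isZero_of_subsingleton (ModuleCat.of R (S i))

end Truncation

/-! ### Inverse limits of towers of complexes. -/

section InverseLimit

open CochainComplex HomComplex

variable {R : Type u} [CommRing R]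

lemma exists_seq_of_forall_exists {α : ℕ → Type*} (r : ∀ n, α n → α (n + 1) → Prop) (a : α 0)
    (h : ∀ n a, ∃ b, r n a b) : ∃ f : ∀ n, α n, ∀ n, r n (f n) (f (n + 1)) :=
  ⟨fun n => Nat.rec a (fun n a => (h n a).choose) n, fun n => (h n _).choose_spec⟩

lemma hom_f_comm_apply {K L : CochainComplex (ModuleCat.{u} R) ℤ} (f : K ⟶ L) (i j : ℤ)
    (x : K.X i) : f.f j (K.d i j x) = L.d i j (f.f i x) :=
  congr($(f.comm i j).hom x).symm

/-- The termwise product of a sequence of complexes. -/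
noncomputable def piComplex (T : ℕ → CochainComplex (ModuleCat.{u} R) ℤ) :
    CochainComplex (ModuleCat.{u} R) ℤ where
  X i := ModuleCat.of R (∀ n, (T n).X i)
  d i j := ModuleCat.ofHom (LinearMap.pi fun n => ((T n).d i j).hom ∘ₗ LinearMap.proj n)
  shape i j h := by
    refine ModuleCat.hom_ext (LinearMap.ext fun x => funext fun n => ?_)
    exact congr($((T n).shape i j h).hom (x n))
  d_comp_d' i j k _ _ := by
    refine ModuleCat.hom_ext (LinearMap.ext fun x => funext fun n => ?_)
    exact d_apply_d_apply (T n) i j k (x n)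

variable (T : ℕ → CochainComplex (ModuleCat.{u} R) ℤ) (p : ∀ n, T (n + 1) ⟶ T n)

/-- The submodule of compatible families in a product. -/
def compatibleFamilies (i : ℤ) : Submodule R ((piComplex T).X i) where
  carrier := {x : ∀ n, (T n).X i | ∀ n, (p n).f i (x (n + 1)) = x n}
  zero_mem' _ := map_zero _
  add_mem' ha hb n := (map_add _ _ _).trans congr($(ha n) + $(hb n))
  smul_mem' c _ hx n := (map_smul _ _ _).trans congr(c • $(hx n))

/-- The inverse limit of a sequence of complexes. -/
noncomputable def towerLimit : CochainComplex (ModuleCat.{u} R) ℤ :=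
  subcomplex (piComplex T) (compatibleFamilies T p) fun i j x hx n =>
    (hom_f_comm_apply (p n) i j (x (n + 1))).trans congr((T n).d i j $(hx n))

/-- The projections of the inverse limit of a sequence of complexes. -/
noncomputable def towerLimitπ (n : ℕ) : towerLimit T p ⟶ T n where
  f i := ModuleCat.ofHom (LinearMap.proj n ∘ₗ (compatibleFamilies T p i).subtype)

variable {T p}

lemma towerLimitπ_f_comp (n : ℕ) (i : ℤ) :
    (towerLimitπ T p (n + 1)).f i ≫ (p n).f i = (towerLimitπ T p n).f i := by
  refine ModuleCat.hom_ext (LinearMap.ext fun x => ?_)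
  exact x.2 n

lemma towerLimit_ext {i : ℤ} {x y : (towerLimit T p).X i}
    (h : ∀ n, (towerLimitπ T p n).f i x = (towerLimitπ T p n).f i y) : x = y :=
  Subtype.ext (funext h)

lemma towerLimit_exists {i : ℤ} (x : ∀ n, (T n).X i) (hx : ∀ n, (p n).f i (x (n + 1)) = x n) :
    ∃ y : (towerLimit T p).X i, ∀ n, (towerLimitπ T p n).f i y = x n :=
  ⟨⟨x, hx⟩, fun _ => rfl⟩

lemma towerLimit_hom_ext {i : ℤ} {A : ModuleCat.{u} R} {f g : A ⟶ (towerLimit T p).X i}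
    (h : ∀ n, f ≫ (towerLimitπ T p n).f i = g ≫ (towerLimitπ T p n).f i) : f = g :=
  ModuleCat.hom_ext (LinearMap.ext fun x => towerLimit_ext fun n => congr($(h n).hom x))

lemma towerLimit_exists_hom {i : ℤ} {A : ModuleCat.{u} R} (f : ∀ n, A ⟶ (T n).X i)
    (hf : ∀ n, f (n + 1) ≫ (p n).f i = f n) :
    ∃ g : A ⟶ (towerLimit T p).X i, ∀ n, g ≫ (towerLimitπ T p n).f i = f n :=
  ⟨ModuleCat.ofHom (LinearMap.codRestrict (compatibleFamilies T p i)
    (LinearMap.pi fun n => (f n).hom) fun x n => congr($(hf n).hom x)), fun _ => rfl⟩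

lemma towerLimit_exists_chainMap {A : CochainComplex (ModuleCat.{u} R) ℤ} (f : ∀ n, A ⟶ T n)
    (hf : ∀ n, f (n + 1) ≫ p n = f n) :
    ∃ g : A ⟶ towerLimit T p, ∀ n, g ≫ towerLimitπ T p n = f n := by
  have h := fun i => towerLimit_exists_hom (p := p) (fun n => (f n).f i)
    (fun n => congr($(hf n).f i))
  choose g hg using h
  refine ⟨{ f := g, comm' := fun i j _ => towerLimit_hom_ext fun n => ?_ }, fun n => ?_⟩
  · rw [Category.assoc, Category.assoc, hg, ← (towerLimitπ T p n).comm, reassoc_of% hg i n,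
      (f n).comm]
  · ext1 i
    exact hg i n

/-- Extensions are chosen level by level; the section of the transition map corrects each new one to
be compatible with the previous one. -/
lemma towerLimit_injective [∀ n i, Injective ((T n).X i)]
    (s : ∀ n i, (T n).X i ⟶ (T (n + 1)).X i) (hs : ∀ n i, s n i ≫ (p n).f i = 𝟙 _) (i : ℤ) :
    Injective ((towerLimit T p).X i) where
  factors {X Y} g f _ := by
    obtain ⟨e, he⟩ := exists_seq_of_forall_exists
      (α := fun n => {e : Y ⟶ (T n).X i // f ≫ e = g ≫ (towerLimitπ T p n).f i})
      (fun n a b => b.1 ≫ (p n).f i = a.1)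
      ⟨Injective.factorThru _ f, Injective.comp_factorThru _ _⟩ (by
        rintro n ⟨a, ha⟩
        let b := Injective.factorThru (g ≫ (towerLimitπ T p (n + 1)).f i) f
        have hb : f ≫ b = g ≫ (towerLimitπ T p (n + 1)).f i := Injective.comp_factorThru _ _
        refine ⟨⟨b - (b ≫ (p n).f i - a) ≫ s n i, ?_⟩, ?_⟩
        · have h0 : f ≫ (b ≫ (p n).f i - a) = 0 := by
            rw [Preadditive.comp_sub, reassoc_of% hb, ha, towerLimitπ_f_comp, sub_self]
          rw [Preadditive.comp_sub, reassoc_of% h0, Limits.zero_comp, sub_zero, hb]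
        · simp [hs])
    obtain ⟨y, hy⟩ := towerLimit_exists_hom (p := p) (fun n => (e n).1) he
    refine ⟨y, towerLimit_hom_ext fun n => ?_⟩
    rw [Category.assoc, hy, (e n).2]

/-- Null-homotopies are made compatible level by level. Two of them into `T n` differ by a cocycle,
hence by a coboundary δβ; β lifts to `T (n + 1)` through the degreewise sections, although these
need not commute with the differentials. -/
lemma towerLimit_isKInjective [∀ n, (T n).IsKInjective]
    (s : ∀ n i, (T n).X i ⟶ (T (n + 1)).X i) (hs : ∀ n i, s n i ≫ (p n).f i = 𝟙 _) :
    (towerLimit T p).IsKInjective where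
  nonempty_homotopy_zero {A} f hA := by
    have hex : ∀ n, ∃ h : Cochain A (T n) (-1),
        δ (-1) 0 h = Cochain.ofHom (f ≫ towerLimitπ T p n) := fun n =>
      IsKInjective.eq_δ_of_cocycle (Cocycle.ofHom (f ≫ towerLimitπ T p n)) hA (-1) (by simp)
    have hπ : ∀ n, towerLimitπ T p (n + 1) ≫ p n = towerLimitπ T p n := fun n => by
      ext1 i
      exact towerLimitπ_f_comp n i
    obtain ⟨e, he⟩ := exists_seq_of_forall_exists
      (α := fun n => {h : Cochain A (T n) (-1) //
        δ (-1) 0 h = Cochain.ofHom (f ≫ towerLimitπ T p n)})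
      (fun n a b => b.1.comp (Cochain.ofHom (p n)) (add_zero _) = a.1)
      ⟨(hex 0).choose, (hex 0).choose_spec⟩ (by
        rintro n ⟨a, ha⟩
        obtain ⟨b, hb⟩ := hex (n + 1)
        have hc : δ (-1) 0 (b.comp (Cochain.ofHom (p n)) (add_zero _) - a) = 0 := by
          rw [δ_sub, δ_comp_ofHom, hb, ha, ← Cochain.ofHom_comp, Category.assoc, hπ, sub_self]
        obtain ⟨β, hβ⟩ := IsKInjective.eq_δ_of_cocycle (Cocycle.mk _ 0 (by simp) hc) hA (-2)
          (by simp)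
        let σ : Cochain (T n) (T (n + 1)) 0 := Cochain.ofHoms (s n)
        have hσ : σ.comp (Cochain.ofHom (p n)) (add_zero 0) = Cochain.ofHom (𝟙 _) := by
          ext i
          simp [σ, hs]
        refine ⟨⟨b - δ (-2) (-1) (β.comp σ (add_zero _)), ?_⟩, ?_⟩
        · rw [δ_sub, δ_δ, sub_zero, hb]
        · have h1 : (β.comp σ (add_zero _)).comp (Cochain.ofHom (p n)) (add_zero _) = β := by
            rw [Cochain.comp_assoc_of_third_is_zero_cochain, hσ, Cochain.comp_id]
          dsimp only
          rw [Cochain.sub_comp, ← δ_comp_ofHom, h1, hβ]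
          exact sub_sub_cancel _ _)
    have h := fun (i j : ℤ) (hij : i + (-1) = j) =>
      towerLimit_exists_hom (p := p) (fun n => (e n).1.v i j hij) (fun n => by
        rw [← he n]
        simp)
    choose g hg using h
    let G : Cochain A (towerLimit T p) (-1) := Cochain.mk g
    have hG : ∀ n, G.comp (Cochain.ofHom (towerLimitπ T p n)) (add_zero _) = (e n).1 := fun n => by
      ext i j hij
      simp [G, hg]
    refine ⟨(Cochain.equivHomotopy f 0).symm ⟨G, ?_⟩⟩
    rw [Cochain.ofHom_zero, add_zero]
    have hA : ∀ n, (δ (-1) 0 G).comp (Cochain.ofHom (towerLimitπ T p n)) (add_zero 0) =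
        Cochain.ofHom (f ≫ towerLimitπ T p n) := fun n => by
      rw [← δ_comp_ofHom, hG, (e n).2]
    refine Cochain.ext₀ _ _ fun i => towerLimit_hom_ext (p := p) fun n => ?_
    simpa using (Cochain.congr_v (hA n) i i (add_zero i)).symm

/-- Surjectivity of H(M) → H(`T n`) makes the transition maps surjective on cohomology, so the lim¹
obstruction vanishes. In each degree the cohomology of the tower eventually equals that of M. -/
lemma towerLimit_quasiIso {M : CochainComplex (ModuleCat.{u} R) ℤ} (φ : ∀ n, M ⟶ T n)
    (hφ : ∀ n, φ (n + 1) ≫ p n = φ n) (hp : ∀ n i, Function.Surjective ((p n).f i))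
    (hsurj : ∀ n (i j k : ℤ), i + 1 = j → j + 1 = k → ∀ z : (T n).X j, (T n).d j k z = 0 →
      ∃ (x : M.X j) (y : (T n).X i), M.d j k x = 0 ∧ z = (φ n).f j x + (T n).d i j y)
    (hinj : ∀ j : ℤ, ∃ N, ∀ n, N ≤ n → QuasiIsoAt (φ n) j)
    (f : M ⟶ towerLimit T p) (hf : ∀ n, f ≫ towerLimitπ T p n = φ n) : QuasiIso f := by
  have hfx : ∀ n i x, (towerLimitπ T p n).f i (f.f i x) = (φ n).f i x := fun n i x =>
    congr(($(hf n).f i).hom x)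
  have hφx : ∀ n i x, (p n).f i ((φ (n + 1)).f i x) = (φ n).f i x := fun n i x =>
    congr(($(hφ n).f i).hom x)
  have hπx : ∀ n i x, (p n).f i ((towerLimitπ T p (n + 1)).f i x) = (towerLimitπ T p n).f i x :=
    fun n i x => congr($(towerLimitπ_f_comp n i).hom x)
  -- Vanishing of lim¹: a new primitive is corrected by a cocycle, which lifts the error of its
  -- image because cohomology classes come from M.
  have key : ∀ i j : ℤ, i + 1 = j → ∀ z : (towerLimit T p).X j,
      (∀ n, ∃ y : (T n).X i, (T n).d i j y = (towerLimitπ T p n).f j z) →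
      ∃ y, (towerLimit T p).d i j y = z := by
    rintro i j hij z hz
    obtain ⟨e, he⟩ := exists_seq_of_forall_exists
      (α := fun n => {y : (T n).X i // (T n).d i j y = (towerLimitπ T p n).f j z})
      (fun n a b => (p n).f i b.1 = a.1) ⟨_, (hz 0).choose_spec⟩ (by
        rintro n ⟨a, ha⟩
        obtain ⟨w, hw⟩ := hz (n + 1)
        obtain ⟨x, b, hx, hb⟩ := hsurj n (i - 1) i j (by lia) hij ((p n).f i w - a) (by
          rw [map_sub, ← hom_f_comm_apply, hw, ha, hπx, sub_self])
        obtain ⟨c, rfl⟩ := hp n _ b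
        refine ⟨⟨w - ((φ (n + 1)).f i x + (T (n + 1)).d (i - 1) i c), ?_⟩, ?_⟩
        · rw [map_sub, map_add, ← hom_f_comm_apply, hx, map_zero, d_apply_d_apply, hw,
            add_zero, sub_zero]
        · dsimp only
          rw [map_sub, map_add, hφx, hom_f_comm_apply, ← hb]
          abel)
    obtain ⟨y, hy⟩ := towerLimit_exists (p := p) (fun n => (e n).1) he
    refine ⟨y, towerLimit_ext fun n => ?_⟩
    rw [hom_f_comm_apply, hy, (e n).2]
  rw [quasiIso_iff_elements]
  intro i j k hij hjk
  obtain ⟨N, hN⟩ := hinj j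
  have hN' := fun n hn => ((quasiIsoAt_iff_elements (φ n) hij hjk).1 (hN n hn)).1
  constructor
  · rintro x hx ⟨y, hy⟩
    refine hN' N le_rfl x hx ⟨(towerLimitπ T p N).f i y, ?_⟩
    rw [← hom_f_comm_apply, hy, hfx]
  · intro z hz
    have hzn : ∀ n, (T n).d j k ((towerLimitπ T p n).f j z) = 0 := fun n => by
      rw [← hom_f_comm_apply, hz, map_zero]
    obtain ⟨x, y, hx, hzx⟩ := hsurj N i j k hij hjk _ (hzn N)
    have hdown : ∀ n m, ∀ x : M.X j, (∃ y, (T (n + m)).d i j y =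
        (towerLimitπ T p (n + m)).f j z - (φ (n + m)).f j x) →
        ∃ y, (T n).d i j y = (towerLimitπ T p n).f j z - (φ n).f j x := by
      intro n m x
      induction m with
      | zero => exact id
      | succ m ih =>
        rintro ⟨y, hy⟩
        refine ih ⟨(p (n + m)).f i y, ?_⟩
        rw [← hom_f_comm_apply, ← hπx, ← hφx, ← map_sub]
        exact congr((p (n + m)).f j $hy)
    -- The class x chosen at level N works at every level: below N by projecting, and above N
    -- because the class x' chosen there agrees with x at level N, where the cohomology of M
    -- injects.
    obtain ⟨y', hy'⟩ := key i j hij (z - f.f j x) (fun n => by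
      rw [map_sub, hfx]
      rcases le_total n N with hn | hn
      · obtain ⟨m, rfl⟩ := Nat.exists_eq_add_of_le hn
        exact hdown n m x ⟨y, by rw [hzx]; abel⟩
      · obtain ⟨x', y', hx', hzx'⟩ := hsurj n i j k hij hjk _ (hzn n)
        obtain ⟨m, rfl⟩ := Nat.exists_eq_add_of_le hn
        obtain ⟨y'', hy''⟩ := hdown N m x' ⟨y', by rw [hzx']; abel⟩
        obtain ⟨w, hw⟩ := hN' N le_rfl (x' - x) (by rw [map_sub, hx, hx', sub_self])
          ⟨y - y'', by rw [map_sub, map_sub, hy'', hzx]; abel⟩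
        refine ⟨y' + (φ (N + m)).f i w, ?_⟩
        rw [map_add, ← hom_f_comm_apply, hw, hzx', map_sub]
        abel)
    refine ⟨x, y', hx, ?_⟩
    rw [hy']
    abel

end InverseLimit

/-! ### Existence of semi-injective resolutions of unbounded complexes. -/

section SemiInjectiveResolution

open CochainComplex Abelian Limits ZeroObject

variable {R : Type u} [CommRing R]

/-- Every class in the cohomology of `L` comes from the cohomology of `M`. -/
def SurjectiveOnCohomology {M L : CochainComplex (ModuleCat.{u} R) ℤ} (φ : M ⟶ L) : Prop :=
  ∀ (i j k : ℤ), i + 1 = j → j + 1 = k → ∀ z : L.X j, L.d j k z = 0 →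
    ∃ (x : M.X j) (y : L.X i), M.d j k x = 0 ∧ z = φ.f j x + L.d i j y

/-- The induced map from the truncation of M at n to L is factored as a quasi-isomorphism followed
by a degreewise epimorphism with injective kernels. Cohomology of K below n is zero, hence
surjectivity on cohomology in all degrees. -/
lemma exists_factorization_truncGE {M L : CochainComplex (ModuleCat.{u} R) ℤ} (φ : M ⟶ L) (m n : ℤ)
    (hmn : m + 1 = n) [L.IsStrictlyGE n] (hL : ∀ i, Injective (L.X i)) :
    ∃ (K : CochainComplex (ModuleCat.{u} R) ℤ) (ψ : M ⟶ K) (p : K ⟶ L), K.IsStrictlyGE m ∧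
      (∀ i, Injective (K.X i)) ∧ SurjectiveOnCohomology ψ ∧ ψ ≫ p = φ ∧
      (∀ i, epiWithInjectiveKernel (p.f i)) ∧ ∀ j, n ≤ j → QuasiIsoAt ψ j := by
  have : L.IsStrictlyGE m := L.isStrictlyGE_of_ge m n (by lia)
  have : (M.truncGE n).IsStrictlyGE (m + 1) := by rw [hmn]; infer_instance
  obtain ⟨K, hK, ι, p, -, hι, hp, hιp⟩ :=
    Plus.modelCategoryQuillen.cm5a (truncGEMap φ n ≫ inv (L.πTruncGE n)) m
  have hq : ∀ j, n ≤ j → QuasiIsoAt (M.πTruncGE n ≫ ι) j := fun j hj => by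
    have := M.quasiIsoAt_πTruncGE n j hj
    infer_instance
  refine ⟨K, M.πTruncGE n ≫ ι, p, hK, fun i => ?_, ?_, ?_, hp, hq⟩
  · have h0 : degreewiseEpiWithInjectiveKernel (0 : L ⟶ 0) :=
      (degreewiseEpiWithInjectiveKernel_iff_of_isZero _ (Limits.isZero_zero _)).2 hL
    exact (degreewiseEpiWithInjectiveKernel_iff_of_isZero _ (Limits.isZero_zero _)).1
      (MorphismProperty.comp_mem _ _ _ hp h0) i
  · intro i j k hij hjk z hz
    by_cases hj : n ≤ j
    · exact ((quasiIsoAt_iff_elements _ hij hjk).1 (hq j hj)).2 z hz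
    · obtain ⟨x, y, -, hzx⟩ := ((quasiIso_iff_elements ι).1 hι i j k hij hjk).2 z hz
      have := ModuleCat.subsingleton_of_isZero ((M.truncGE n).isZero_of_isStrictlyGE n j (by lia))
      refine ⟨0, y, map_zero _, ?_⟩
      rw [hzx, Subsingleton.elim x 0, map_zero, map_zero]
  · rw [Category.assoc, hιp, πTruncGE_naturality_assoc, IsIso.hom_inv_id, Category.comp_id]

/-- The limit of a tower starting at 0, whose stage n lives in degrees ≥ -n and consists of
injectives, so is K-injective as a bounded below complex. -/
theorem exists_quasiIso_isSemiInjective (M : CochainComplex (ModuleCat.{u} R) ℤ) :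
    ∃ (I : CochainComplex (ModuleCat.{u} R) ℤ) (f : M ⟶ I), IsSemiInjective I ∧ QuasiIso f := by
  have h0 : ∀ i, IsZero ((0 : CochainComplex (ModuleCat.{u} R) ℤ).X i) := fun i =>
    Functor.map_isZero (HomologicalComplex.eval (ModuleCat.{u} R) (.up ℤ) i) (isZero_zero _)
  obtain ⟨e, he⟩ := exists_seq_of_forall_exists
    (α := fun n => {s : Σ (L : CochainComplex (ModuleCat.{u} R) ℤ), (M ⟶ L) //
      s.1.IsStrictlyGE (-n) ∧ (∀ i, Injective (s.1.X i)) ∧ SurjectiveOnCohomology s.2})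
    (fun n a b => ∃ p : b.1.1 ⟶ a.1.1, b.1.2 ≫ p = a.1.2 ∧
      (∀ i, epiWithInjectiveKernel (p.f i)) ∧ ∀ j, -(n : ℤ) ≤ j → QuasiIsoAt b.1.2 j)
    ⟨⟨0, 0⟩, (isStrictlyGE_iff _ _).2 fun i _ => h0 i, fun i => (h0 i).injective,
      fun i j _ _ _ z _ => ⟨0, 0, map_zero _, by
        have := ModuleCat.subsingleton_of_isZero (h0 j)
        exact Subsingleton.elim (α := (0 : CochainComplex (ModuleCat.{u} R) ℤ).X j) _ _⟩⟩ (by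
      rintro n ⟨⟨L, φ⟩, hL, hLi, hφ⟩
      obtain ⟨K, ψ, p, hK, hKi, hψ, hψp, hp, hq⟩ :=
        exists_factorization_truncGE φ (-(n + 1 : ℕ)) (-n) (by push_cast; lia) hLi
      exact ⟨⟨⟨K, ψ⟩, hK, hKi, hψ⟩, p, hψp, hp, hq⟩)
  let T := fun n => (e n).1.1
  let φ : ∀ n, M ⟶ T n := fun n => (e n).1.2
  choose p hp hpi hq using he
  have hs : ∀ n i, ∃ s : (T n).X i ⟶ (T (n + 1)).X i, s ≫ (p n).f i = 𝟙 _ := fun n i => by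
    obtain ⟨_, _, _, _, ⟨σ⟩⟩ := (epiWithInjectiveKernel_iff _).1 (hpi n i)
    exact ⟨σ.s, σ.s_g⟩
  choose s hs using hs
  have hinj : ∀ n i, Injective ((T n).X i) := fun n => (e n).2.2.1
  have hKinj : ∀ n, (T n).IsKInjective := fun n => by
    have := (e n).2.1
    have := hinj n
    exact isKInjective_of_injective (T n) (-n)
  obtain ⟨f, hf⟩ := towerLimit_exists_chainMap (T := T) (p := p) φ hp
  refine ⟨towerLimit T p, f, ⟨towerLimit_injective s hs, towerLimit_isKInjective s hs⟩,
    towerLimit_quasiIso φ hp (fun n i b => ⟨s n i b, congr($(hs n i).hom b)⟩)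
      (fun n => (e n).2.2.2) (fun j => ⟨(-j).toNat + 1, fun n hn => ?_⟩) f hf⟩
  -- Stage m + 1 is only known to be correct in degrees ≥ -m, whence the extra 1.
  obtain ⟨m, rfl⟩ := Nat.exists_eq_add_of_le' (Nat.le_of_add_left_le hn)
  exact hq m j (by lia)

end SemiInjectiveResolution

/-! ### Hom complexes preserve quasi-isomorphisms, via acyclic mapping cones. -/

section HomComplexQuasiIso

open CochainComplex HomComplex

section

variable {C : Type*} [Category* C] [Abelian C]

lemma acyclic_mappingCone {K L : CochainComplex C ℤ}
    (f : K ⟶ L) [hf : QuasiIso f] : (mappingCone f).Acyclic := by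
  rw [← HomotopyCategory.quotient_obj_mem_subcategoryAcyclic_iff_acyclic]
  refine ((HomotopyCategory.subcategoryAcyclic C).trW_iff_of_distinguished _
    (HomotopyCategory.mappingCone_triangleh_distinguished f)).1 ?_
  rw [← HomotopyCategory.quasiIso_eq_trW_subcategoryAcyclic]
  exact (HomotopyCategory.quotient_map_mem_quasiIso_iff f).2 hf

lemma acyclic_shift {L : CochainComplex C ℤ} (hL : L.Acyclic) (n : ℤ) :
    (L⟦n⟧).Acyclic := by
  rw [← HomotopyCategory.quotient_obj_mem_subcategoryAcyclic_iff_acyclic] at hL ⊢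
  exact ObjectProperty.prop_of_iso _
    (((HomotopyCategory.quotient C (.up ℤ)).commShiftIso n).symm.app L)
    ((HomotopyCategory.subcategoryAcyclic C).le_shift n _ hL)

/-- A cocycle of degree n is a morphism into the shift of L by n, which is again acyclic. -/
lemma CochainComplex.IsKProjective.eq_δ_of_cocycle {K L : CochainComplex C ℤ} {n : ℤ}
    (z : Cocycle K L n) [K.IsKProjective] (hL : L.Acyclic) (m : ℤ) (hm : m + 1 = n) :
    ∃ (α : Cochain K L m), δ m n α = z.1 := by
  obtain ⟨φ, hφ⟩ := (Cocycle.equivHom ..).surjective (z.rightShift n 0 (zero_add n))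
  have hφ' : Cochain.ofHom φ = z.1.rightShift n 0 (zero_add n) := congr_arg Subtype.val hφ
  obtain ⟨h⟩ := IsKProjective.nonempty_homotopy_zero φ (acyclic_shift hL n)
  obtain ⟨f, hf⟩ := Cochain.equivHomotopy _ _ h
  rw [Cochain.ofHom_zero, add_zero] at hf
  refine ⟨n.negOnePow • Cochain.rightUnshift f m (by lia), ?_⟩
  rw [δ_units_smul, Cochain.δ_rightUnshift f m (by lia) n 0 (by lia), ← hf, hφ',
    Cochain.rightUnshift_rightShift, smul_smul, Int.units_mul_self, one_smul]

variable {P Q L M : CochainComplex C ℤ} {n m : ℤ}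

/-- Surjectivity of Hom(Q, L) → Hom(P, L) on cohomology: z, extended by 0 on Q, is a cocycle on the
acyclic cone of φ. The two components of a primitive are w, up to sign, and y. -/
lemma CochainComplex.IsKInjective.exists_cocycle_precomp [L.IsKInjective] (φ : P ⟶ Q) [QuasiIso φ]
    (z : Cocycle P L n) (hm : m + 1 = n) :
    ∃ (w : Cocycle Q L n) (y : Cochain P L m),
      z.1 = (Cochain.ofHom φ).comp w.1 (zero_add n) + δ m n y := by
  obtain ⟨γ, hγ⟩ := IsKInjective.eq_δ_of_cocycle
    (mappingCone.descCocycle φ z.1 (0 : Cocycle Q L (n + 1)) rfl (by simp))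
    (acyclic_mappingCone φ) n rfl
  rw [mappingCone.descCocycle_coe] at hγ
  let w : Cochain Q L n := (Cochain.ofHom (mappingCone.inr φ)).comp γ (zero_add n)
  have hw : δ n (n + 1) w = 0 := by
    rw [δ_ofHom_comp, hγ, mappingCone.inr_descCochain]
    rfl
  refine ⟨-n.negOnePow • Cocycle.mk w (n + 1) rfl hw,
    (mappingCone.inl φ).comp γ (by lia), ?_⟩
  rw [δ_comp _ _ _ 0 (n + 1) n hm (by simp) rfl, hγ, mappingCone.inl_descCochain,
    mappingCone.δ_inl, Cochain.ofHom_comp, Cochain.comp_assoc_of_first_is_zero_cochain]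
  simp [w]

/-- Injectivity on cohomology: w and y, with a sign, form a cocycle on the cone, and the Q-component
of a primitive bounds w. -/
lemma CochainComplex.IsKInjective.exists_eq_δ_of_precomp [L.IsKInjective] (φ : P ⟶ Q) [QuasiIso φ]
    (w : Cocycle Q L n) (hm : m + 1 = n) (y : Cochain P L m)
    (h : (Cochain.ofHom φ).comp w.1 (zero_add n) = δ m n y) : ∃ y', w.1 = δ m n y' := by
  obtain ⟨γ, hγ⟩ := IsKInjective.eq_δ_of_cocycle
    (mappingCone.descCocycle φ (n.negOnePow • y) w hm (by rw [δ_units_smul, h]))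
    (acyclic_mappingCone φ) m hm
  refine ⟨(Cochain.ofHom (mappingCone.inr φ)).comp γ (zero_add m), ?_⟩
  rw [δ_ofHom_comp, hγ, mappingCone.descCocycle_coe, mappingCone.inr_descCochain]

/-- The dual argument, with cocycles into the cone. -/
lemma CochainComplex.IsKProjective.exists_cocycle_postcomp [P.IsKProjective] (φ : L ⟶ M)
    [QuasiIso φ] (z : Cocycle P M n) (hm : m + 1 = n) :
    ∃ (w : Cocycle P L n) (y : Cochain P M m),
      z.1 = w.1.comp (Cochain.ofHom φ) (add_zero n) + δ m n y := by
  obtain ⟨γ, hγ⟩ := IsKProjective.eq_δ_of_cocycle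
    (mappingCone.liftCocycle φ (0 : Cocycle P L (n + 1)) z.1 rfl (by simp))
    (acyclic_mappingCone φ) m hm
  rw [mappingCone.liftCocycle_coe] at hγ
  have h1 := congr(Cochain.comp $hγ (mappingCone.fst φ).1 rfl)
  have h2 := congr(Cochain.comp $hγ (mappingCone.snd φ) (add_zero n))
  rw [mappingCone.liftCochain_fst] at h1
  rw [mappingCone.liftCochain_snd] at h2
  have h3 := δ_comp γ (mappingCone.fst φ).1 hm n 2 (n + 1) rfl hm (by simp)
  have h4 := δ_comp γ (mappingCone.snd φ) (add_zero m) n 1 n hm hm (by simp)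
  rw [h1] at h3
  rw [h2, mappingCone.δ_snd] at h4
  refine ⟨Cocycle.mk (γ.comp (mappingCone.fst φ).1 hm) (n + 1) rfl (by simpa using h3),
    γ.comp (mappingCone.snd φ) (add_zero m), ?_⟩
  rw [h4]
  simp

lemma CochainComplex.IsKProjective.exists_eq_δ_of_postcomp [P.IsKProjective] (φ : L ⟶ M)
    [QuasiIso φ] (w : Cocycle P L n) (hm : m + 1 = n) (y : Cochain P M m)
    (h : w.1.comp (Cochain.ofHom φ) (add_zero n) = δ m n y) : ∃ y', w.1 = δ m n y' := by
  obtain ⟨l, hl⟩ : ∃ l, l + 1 = m := ⟨m - 1, by lia⟩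
  obtain ⟨γ, hγ⟩ := IsKProjective.eq_δ_of_cocycle
    (mappingCone.liftCocycle φ w (-y) hm (by rw [δ_neg, h, neg_add_cancel]))
    (acyclic_mappingCone φ) l hl
  rw [mappingCone.liftCocycle_coe] at hγ
  have h1 := congr(Cochain.comp $hγ (mappingCone.fst φ).1 hm)
  rw [mappingCone.liftCochain_fst] at h1
  have h3 := δ_comp γ (mappingCone.fst φ).1 hl m 2 n hm hl (by simp)
  rw [h1] at h3
  refine ⟨-(γ.comp (mappingCone.fst φ).1 hl), ?_⟩
  rw [δ_neg, h3]
  simp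

end

end HomComplexQuasiIso

/-! ### The complexes Hom(F, I) and Hom(P, I). -/

section HomFromModule

open CochainComplex HomComplex TensorProduct

variable {R : Type u} [CommRing R]

/-- The map `Hom(P, M) ⟶ Hom(P, N)` induced by `f : M ⟶ N`. -/
noncomputable def homComplexPostcomp (P : CochainComplex (ModuleCat.{u} R) ℤ)
    {M N : CochainComplex (ModuleCat.{u} R) ℤ} (f : M ⟶ N) : homComplex P M ⟶ homComplex P N where
  f n := ModuleCat.ofHom
    { toFun := fun z : Cochain P M n => z.comp (Cochain.ofHom f) (add_zero n)
      map_add' := fun z w => Cochain.add_comp _ _ _ _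
      map_smul' := fun r z => Cochain.smul_comp _ _ _ _ }
  comm' n m _ := by
    refine ModuleCat.hom_ext (LinearMap.ext fun z => ?_)
    exact δ_comp_ofHom (n := n) z f m

lemma quasiIso_homComplexPostcomp (P : CochainComplex (ModuleCat.{u} R) ℤ) [P.IsKProjective]
    {M N : CochainComplex (ModuleCat.{u} R) ℤ} (f : M ⟶ N) [QuasiIso f] :
    QuasiIso (homComplexPostcomp P f) := by
  rw [quasiIso_iff_elements]
  intro i j k hij hjk
  constructor
  · rintro x hx ⟨y, hy⟩
    obtain ⟨w, hw⟩ := IsKProjective.exists_eq_δ_of_postcomp f (Cocycle.mk x k hjk hx) hij y hy.symm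
    exact ⟨w, hw.symm⟩
  · intro z hz
    obtain ⟨w, y, h⟩ := IsKProjective.exists_cocycle_postcomp f (Cocycle.mk z k hjk hz) hij
    exact ⟨w.1, y, w.δ_eq_zero k, h⟩

variable (F : Type u) [AddCommGroup F] [Module R F]

/-- The complex `Hom(F, I)` for a module `F`. -/
noncomputable def homModuleComplex (I : CochainComplex (ModuleCat.{u} R) ℤ) :
    CochainComplex (ModuleCat.{u} R) ℤ where
  X i := ModuleCat.of R (F →ₗ[R] I.X i)
  d i j := ModuleCat.ofHom ((I.d i j).hom.compRight R)
  shape i j h := by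
    refine ModuleCat.hom_ext (LinearMap.ext fun x => LinearMap.ext fun a => ?_)
    exact congr($(I.shape i j h).hom (x a))
  d_comp_d' i j k _ _ := by
    refine ModuleCat.hom_ext (LinearMap.ext fun x => LinearMap.ext fun a => ?_)
    exact d_apply_d_apply I i j k (x a)

/-- The complex `A ⊗ F` for a module `F`. -/
noncomputable def tensorModuleComplex (A : CochainComplex (ModuleCat.{u} R) ℤ) :
    CochainComplex (ModuleCat.{u} R) ℤ where
  X i := ModuleCat.of R (A.X i ⊗[R] F)
  d i j := ModuleCat.ofHom ((A.d i j).hom.rTensor F)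
  shape i j h := by
    rw [A.shape i j h, ModuleCat.hom_zero, LinearMap.rTensor_zero, ModuleCat.ofHom_zero]
  d_comp_d' i j k _ _ := by
    rw [← ModuleCat.ofHom_comp, ← LinearMap.rTensor_comp, ← ModuleCat.hom_comp, A.d_comp_d,
      ModuleCat.hom_zero, LinearMap.rTensor_zero, ModuleCat.ofHom_zero]

lemma tensorModuleComplex_acyclic [Module.Flat R F] {A : CochainComplex (ModuleCat.{u} R) ℤ}
    (hA : A.Acyclic) : (tensorModuleComplex F A).Acyclic := by
  intro j
  rw [exactAt_iff_forall_exists (sub_add_cancel j 1) rfl]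
  have h := (exactAt_iff_forall_exists (sub_add_cancel j 1) rfl).1 (hA j)
  have hex : Function.Exact (A.d (j - 1) j).hom (A.d j (j + 1)).hom := fun x =>
    ⟨h x, by rintro ⟨y, rfl⟩; exact d_apply_d_apply A _ _ _ y⟩
  exact fun x hx => (Module.Flat.rTensor_exact F hex x).1 hx

/-- A map A → Hom(F, I) is a map A ⊗ F → I, with A ⊗ F acyclic by flatness; currying a null-homotopy
of the latter gives one of the former. -/
lemma homModuleComplex_isKInjective [Module.Flat R F] (I : CochainComplex (ModuleCat.{u} R) ℤ)
    [I.IsKInjective] : (homModuleComplex F I).IsKInjective where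
  nonempty_homotopy_zero {A} φ hA := by
    let ψ : tensorModuleComplex F A ⟶ I :=
      { f := fun i => ModuleCat.ofHom (TensorProduct.lift (φ.f i).hom)
        comm' := fun i j _ => by
          refine ModuleCat.hom_ext (TensorProduct.ext' fun a b => ?_)
          have h : (homModuleComplex F I).d i j (φ.f i a) = φ.f j (A.d i j a) :=
            congr($(φ.comm i j).hom a)
          exact congr((show F →ₗ[R] I.X j from $h) b) }
    obtain ⟨α, hα⟩ := IsKInjective.eq_δ_of_cocycle (Cocycle.ofHom ψ)
      (tensorModuleComplex_acyclic F hA) (-1) (by simp)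
    let β : Cochain A (homModuleComplex F I) (-1) := Cochain.mk fun i j hij =>
      ModuleCat.ofHom (TensorProduct.curry (α.v i j hij).hom)
    refine ⟨(Cochain.equivHomotopy φ 0).symm ⟨β, ?_⟩⟩
    rw [Cochain.ofHom_zero, add_zero]
    refine Cochain.ext₀ _ _ fun i =>
      ModuleCat.hom_ext (LinearMap.ext fun a => LinearMap.ext fun b => ?_)
    have h := congr(($(Cochain.congr_v hα i i (add_zero i))).hom (a ⊗ₜ[R] b))
    rw [δ_v (-1) 0 (by simp) _ i i (by simp) (i - 1) (i + 1) (by lia) (by lia)] at h ⊢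
    simp at h ⊢
    exact h.symm

lemma homModule_injective [Module.Flat R F] (Q : Type u) [AddCommGroup Q] [Module R Q]
    [Module.Injective R Q] : Module.Injective R (F →ₗ[R] Q) where
  out X Y _ _ _ _ f hf g := by
    obtain ⟨h, hh⟩ := Module.Injective.extension_property R Q (X ⊗[R] F) (Y ⊗[R] F)
      (f.rTensor F) (Module.Flat.rTensor_preserves_injective_linearMap f hf) (TensorProduct.lift g)
    exact ⟨TensorProduct.curry h, fun x => LinearMap.ext fun a => congr($hh (x ⊗ₜ[R] a))⟩

lemma homModuleComplex_isSemiInjective [Module.Flat R F] {I : CochainComplex (ModuleCat.{u} R) ℤ}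
    (hI : IsSemiInjective I) : IsSemiInjective (homModuleComplex F I) where
  injective i := by
    have := (Module.injective_iff_injective_object R (I.X i)).2 (hI.injective i)
    exact (Module.injective_iff_injective_object R (F →ₗ[R] I.X i)).1 (homModule_injective F _)
  isKInjective := by
    have := hI.isKInjective
    exact homModuleComplex_isKInjective F I

/-- The map `Hom(F, I) ⟶ Hom(P, I)` induced by a map from `P` to the module `F`. -/
noncomputable def homModuleComplexToHomComplex {P : CochainComplex (ModuleCat.{u} R) ℤ}
    (π : P ⟶ (singleFunctor (ModuleCat.{u} R) 0).obj (ModuleCat.of R F))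
    (I : CochainComplex (ModuleCat.{u} R) ℤ) : homModuleComplex F I ⟶ homComplex P I where
  f n := ModuleCat.ofHom
    { toFun := fun z : F →ₗ[R] I.X n => (Cochain.ofHom π).comp
        (Cochain.fromSingleMk (X := ModuleCat.of R F) (ModuleCat.ofHom z) (zero_add n)) (zero_add n)
      map_add' := fun z w => by
        rw [ModuleCat.ofHom_add, Cochain.fromSingleMk_add, Cochain.comp_add]
      map_smul' := fun r z => by
        have h : Cochain.fromSingleMk (X := ModuleCat.of R F) (ModuleCat.ofHom (r • z))
            (zero_add n) = r • Cochain.fromSingleMk (X := ModuleCat.of R F) (ModuleCat.ofHom z)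
              (zero_add n) := by
          apply (Cochain.fromSingleEquiv (zero_add n)).injective
          simp [Cochain.fromSingleEquiv]
          rfl
        rw [h, Cochain.comp_smul]
        rfl }
  comm' n m _ := by
    refine ModuleCat.hom_ext (LinearMap.ext fun z => ?_)
    refine (δ_ofHom_comp (n := n) π _ m).trans ?_
    rw [Cochain.δ_fromSingleMk _ _ m m (zero_add m)]
    rfl

/-- Cochains from F placed in degree 0 are linear maps F → I^n, so this is precomposition with the
quasi-isomorphism π into a K-injective complex. -/
lemma quasiIso_homModuleComplexToHomComplex {P : CochainComplex (ModuleCat.{u} R) ℤ}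
    (π : P ⟶ (singleFunctor (ModuleCat.{u} R) 0).obj (ModuleCat.of R F)) [QuasiIso π]
    (I : CochainComplex (ModuleCat.{u} R) ℤ) [I.IsKInjective] :
    QuasiIso (homModuleComplexToHomComplex F π I) := by
  rw [quasiIso_iff_elements]
  intro i j k hij hjk
  have hmk : ∀ (n m : ℤ) (y : F →ₗ[R] I.X n), δ n m
      (Cochain.fromSingleMk (X := ModuleCat.of R F) (ModuleCat.ofHom y) (zero_add n)) =
      Cochain.fromSingleMk (X := ModuleCat.of R F) (ModuleCat.ofHom ((I.d n m).hom ∘ₗ y))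
        (zero_add m) := fun n m y => by
    rw [Cochain.δ_fromSingleMk _ _ m m (zero_add m), ModuleCat.ofHom_comp, ModuleCat.ofHom_hom]
  have hsurj : ∀ (n : ℤ) (z : Cochain ((singleFunctor (ModuleCat.{u} R) 0).obj (ModuleCat.of R F))
      I n), ∃ y : F →ₗ[R] I.X n, Cochain.fromSingleMk (X := ModuleCat.of R F) (ModuleCat.ofHom y)
        (zero_add n) = z := fun n z => by
    obtain ⟨f, hf⟩ := Cochain.fromSingleMk_surjective z n (zero_add n)
    exact ⟨f.hom, hf⟩
  have hinj : ∀ (n : ℤ) (y y' : F →ₗ[R] I.X n),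
      Cochain.fromSingleMk (X := ModuleCat.of R F) (ModuleCat.ofHom y) (zero_add n) =
        Cochain.fromSingleMk (X := ModuleCat.of R F) (ModuleCat.ofHom y') (zero_add n) → y = y' :=
    fun n y y' h => congr($((Cochain.fromSingleEquiv (zero_add n)).symm.injective h).hom)
  constructor
  · rintro (x : F →ₗ[R] I.X j) (hx : (I.d j k).hom ∘ₗ x = 0) ⟨y, hy⟩
    obtain ⟨w, hw⟩ := IsKInjective.exists_eq_δ_of_precomp π (Cocycle.mk (Cochain.fromSingleMk
      (X := ModuleCat.of R F) (ModuleCat.ofHom x) (zero_add j)) k hjk (by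
        rw [hmk, hx, ModuleCat.ofHom_zero, Cochain.fromSingleMk_zero])) hij y hy.symm
    obtain ⟨v, rfl⟩ := hsurj i w
    refine ⟨v, hinj j _ _ ?_⟩
    exact (hw.trans (hmk i j v)).symm
  · intro z hz
    obtain ⟨w, y, h⟩ := IsKInjective.exists_cocycle_precomp π (Cocycle.mk z k hjk hz) hij
    obtain ⟨v, hv⟩ := hsurj j w.1
    refine ⟨v, y, hinj k _ 0 ?_, ?_⟩
    · have h0 := w.δ_eq_zero k
      rw [← hv, hmk] at h0
      rw [ModuleCat.ofHom_zero, Cochain.fromSingleMk_zero]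
      exact h0
    · rw [← hv] at h
      exact h

end HomFromModule

/-! ### Comparison of injective dimensions and of acyclicity. -/

section InjectiveDimension

open CochainComplex HomComplex TensorProduct Limits ZeroObject

variable {R : Type u} [CommRing R]

/-- The identity of J extends along s up to homotopy. This reverses Hom(F, I) → Hom(P, I), as a
resolution must be a map out of RHom(F, M). -/
lemma exists_quasiIso_of_isKInjective {J H : CochainComplex (ModuleCat.{u} R) ℤ} [J.IsKInjective]
    (s : J ⟶ H) [QuasiIso s] : ∃ r : H ⟶ J, QuasiIso r := by
  obtain ⟨w, y, h⟩ := IsKInjective.exists_cocycle_precomp (m := -1) s (Cocycle.ofHom (𝟙 J))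
    (by simp)
  have hw : w.1 = Cochain.ofHom w.homOf := (Cocycle.cochain_ofHom_homOf_eq_coe w).symm
  have H₁ : Homotopy (𝟙 J) (s ≫ w.homOf) := (Cochain.equivHomotopy _ _).symm ⟨y, by
    rw [Cochain.ofHom_comp, ← hw, add_comm]
    exact h⟩
  have : QuasiIso (s ≫ w.homOf) := by
    rw [quasiIso_iff]
    intro i
    rw [quasiIsoAt_iff_isIso_homologyMap, ← H₁.homologyMap_eq i]
    infer_instance
  exact ⟨w.homOf, quasiIso_of_comp_left s w.homOf⟩

/-- Two K-injective resolutions of X are homotopy equivalent, so the identity of J is homotopic to a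
map through a complex that is zero above n. Applied to a cocycle above n, the homotopy gives a
primitive. -/
lemma liftsAbove_of_injDimLE {X J : CochainComplex (ModuleCat.{u} R) ℤ} [J.IsKInjective]
    (g : X ⟶ J) [QuasiIso g] {n : ℤ} (h : InjDimLE X n) (N : Type u) [AddCommGroup N]
    [Module R N] : LiftsAbove J n N := by
  obtain ⟨J', g', hJ', _, _⟩ := h
  have := hJ'.isKInjective
  obtain ⟨v, y, hv⟩ := IsKInjective.exists_cocycle_precomp (m := -1) g (Cocycle.ofHom g') (by simp)
  obtain ⟨w, y', hw⟩ := IsKInjective.exists_cocycle_precomp (m := -1) g' (Cocycle.ofHom g) (by simp)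
  have hv' : v.1 = Cochain.ofHom v.homOf := (Cocycle.cochain_ofHom_homOf_eq_coe v).symm
  have hw' : w.1 = Cochain.ofHom w.homOf := (Cocycle.cochain_ofHom_homOf_eq_coe w).symm
  rw [Cocycle.ofHom_coe, hv'] at hv
  rw [Cocycle.ofHom_coe, hw'] at hw
  obtain ⟨e, he⟩ := IsKInjective.exists_eq_δ_of_precomp (m := -1) g
    (Cocycle.ofHom (𝟙 J - v.homOf ≫ w.homOf)) (by simp)
    (y' + y.comp (Cochain.ofHom w.homOf) (add_zero _)) (by
      have hy : δ (-1) 0 y = Cochain.ofHom g' - Cochain.ofHom (g ≫ v.homOf) := by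
        rw [hv, Cochain.ofHom_comp, add_sub_cancel_left]
      have hy' : δ (-1) 0 y' = Cochain.ofHom g - Cochain.ofHom (g' ≫ w.homOf) := by
        rw [hw, Cochain.ofHom_comp, add_sub_cancel_left]
      rw [δ_add, δ_comp_ofHom, hy, hy', Cocycle.ofHom_coe, Cochain.sub_comp, ← Cochain.ofHom_comp,
        ← Cochain.ofHom_comp, ← Cochain.ofHom_comp, sub_add_sub_cancel, ← Cochain.ofHom_sub,
        Preadditive.comp_sub, Category.comp_id, Category.assoc])
  intro i hi f hf
  -- As J' vanishes in degree i + 1 > n, the homotopy relation here says that 1 = de + ed on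
  -- J^{i+1}.
  have h0 : (𝟙 J - v.homOf ≫ w.homOf).f (i + 1) = 𝟙 _ := by
    have : v.homOf.f (i + 1) = 0 := (J'.isZero_of_isStrictlyLE n (i + 1) (by lia)).eq_of_tgt _ _
    rw [HomologicalComplex.sub_f_apply, HomologicalComplex.comp_f, this, Limits.zero_comp, sub_zero,
      HomologicalComplex.id_f]
  have h1 := Cochain.congr_v he (i + 1) (i + 1) (add_zero _)
  rw [Cocycle.ofHom_coe, Cochain.ofHom_v, h0,
    δ_v (-1) 0 (by simp) _ (i + 1) (i + 1) (by simp) i (i + 1 + 1) (by lia) (by lia)] at h1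
  refine ⟨(e.v (i + 1) i (by lia)).hom ∘ₗ f, LinearMap.ext fun x => ?_⟩
  have h2 := congr($(h1).hom (f x))
  have h3 : (J.d (i + 1) (i + 1 + 1)).hom (f x) = 0 := congr($hf x)
  simpa [h3] using h2.symm

lemma LiftsAbove.tensorProduct_of_homModuleComplex {F : Type u} [AddCommGroup F] [Module R F]
    {I : CochainComplex (ModuleCat.{u} R) ℤ} {n : ℤ} {N : Type u} [AddCommGroup N] [Module R N]
    (h : LiftsAbove (homModuleComplex F I) n N) : LiftsAbove I n (N ⊗[R] F) := by
  intro i hi f hf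
  obtain ⟨g, hg⟩ := h i hi (TensorProduct.curry f)
    (LinearMap.ext fun x => LinearMap.ext fun a => congr($hf (x ⊗ₜ[R] a)))
  refine ⟨TensorProduct.lift g, TensorProduct.ext' fun x a => ?_⟩
  exact congr((show F →ₗ[R] I.X (i + 1) from $hg x) a)

lemma acyclic_iff_forall_injDimLE (M : CochainComplex (ModuleCat.{u} R) ℤ) :
    M.Acyclic ↔ ∀ n, InjDimLE M n := by
  constructor
  · intro hM n
    have hz : ∀ i, IsZero ((0 : CochainComplex (ModuleCat.{u} R) ℤ).X i) := fun i =>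
      Functor.map_isZero (HomologicalComplex.eval (ModuleCat.{u} R) (.up ℤ) i) (isZero_zero _)
    refine ⟨0, 0, ⟨fun i => (hz i).injective, ⟨fun φ _ => ⟨.ofEq ((isZero_zero _).eq_of_tgt _ _)⟩⟩⟩,
      (quasiIso_iff_elements _).2 fun i j k hij hjk => ⟨fun x hx _ => ?_, fun z _ => ?_⟩,
      (isStrictlyLE_iff _ _).2 fun i _ => hz i⟩
    · exact (exactAt_iff_forall_exists hij hjk).1 (hM j) x hx
    · have := fun i => ModuleCat.subsingleton_of_isZero (hz i)
      exact ⟨0, 0, map_zero _, Subsingleton.elim _ _⟩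
  · intro h j
    -- The bound j - 1 makes the resolution vanish in degree j itself.
    obtain ⟨I, f, -, hf, hI⟩ := h (j - 1)
    have h0 : I.ExactAt j :=
      ShortComplex.exact_of_isZero_X₂ _ (I.isZero_of_isStrictlyLE (j - 1) j (by lia))
    rw [HomologicalComplex.exactAt_iff_isZero_homology] at h0 ⊢
    exact h0.of_iso (asIso (HomologicalComplex.homologyMap f j))

variable (F : Type u) [AddCommGroup F] [Module R F]

lemma exists_quasiIso_rHom_homModuleComplex [Module.Flat R F]
    {M I : CochainComplex (ModuleCat.{u} R) ℤ} (f : M ⟶ I) [QuasiIso f] (hI : IsSemiInjective I) :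
    ∃ g : rHom R F M ⟶ homModuleComplex F I, QuasiIso g := by
  have := hI.isKInjective
  have := (homModuleComplex_isSemiInjective F hI).isKInjective
  let P := projectiveResolution (ModuleCat.of R F)
  have : P.cochainComplex.IsKProjective := isKProjective_of_projective _ 0
  have := quasiIso_homModuleComplexToHomComplex F P.π' I
  have := quasiIso_homComplexPostcomp P.cochainComplex f
  obtain ⟨r, hr⟩ := exists_quasiIso_of_isKInjective (homModuleComplexToHomComplex F P.π' I)
  exact ⟨homComplexPostcomp P.cochainComplex f ≫ r,
    quasiIso_comp (homComplexPostcomp P.cochainComplex f) r⟩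

/-- Forward, the lifting property descends from Hom(F, I) to I through the modules N ⊗ F. Backward,
Hom(F, I) resolves RHom(F, M) and vanishes wherever I does. -/
theorem injDimLE_rHom_iff [IsNoetherianRing R] [Module.FaithfullyFlat R F]
    (M : CochainComplex (ModuleCat.{u} R) ℤ) (n : ℤ) :
    InjDimLE (rHom R F M) n ↔ InjDimLE M n := by
  constructor
  · intro h
    obtain ⟨I, f, hI, hf⟩ := exists_quasiIso_isSemiInjective M
    have := fun i => (Module.injective_iff_injective_object R (I.X i)).2 (hI.injective i)
    obtain ⟨g, hg⟩ := exists_quasiIso_rHom_homModuleComplex F f hI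
    have := (homModuleComplex_isSemiInjective F hI).isKInjective
    exact injDimLE_of_liftsAbove f hI n fun N _ _ => LiftsAbove.of_tensorProduct F fun N _ _ =>
      (liftsAbove_of_injDimLE g h N).tensorProduct_of_homModuleComplex
  · rintro ⟨I, f, hI, hf, hn⟩
    obtain ⟨g, hg⟩ := exists_quasiIso_rHom_homModuleComplex F f hI
    refine ⟨_, g, homModuleComplex_isSemiInjective F hI, hg, ?_⟩
    rw [isStrictlyLE_iff]
    intro i hi
    have := ModuleCat.subsingleton_of_isZero (I.isZero_of_isStrictlyLE n i hi)
    exact ModuleCat.isZero_of_subsingleton (ModuleCat.of R (F →ₗ[R] I.X i))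

theorem injDim_rHom [IsNoetherianRing R] [Module.FaithfullyFlat R F]
    (M : CochainComplex (ModuleCat.{u} R) ℤ) : injDim (rHom R F M) = injDim M := by
  simp only [injDim, injDimLE_rHom_iff]

theorem acyclic_rHom_iff [IsNoetherianRing R] [Module.FaithfullyFlat R F]
    (M : CochainComplex (ModuleCat.{u} R) ℤ) : (rHom R F M).Acyclic ↔ M.Acyclic := by
  simp only [acyclic_iff_forall_injDimLE, injDimLE_rHom_iff]

end InjectiveDimension

/-! ### Modules M with injective Hom(F, M). -/

section HomInjective

open CochainComplex HomComplex TensorProduct Limits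

variable {R : Type u} [CommRing R]

lemma subsingleton_single_X (A : ModuleCat.{u} R) {j : ℤ} (hj : j ≠ 0) :
    Subsingleton (((HomologicalComplex.single (ModuleCat.{u} R) (.up ℤ) 0).obj A).X j) :=
  ModuleCat.subsingleton_of_isZero (HomologicalComplex.isZero_single_obj_X _ _ _ _ hj)

lemma quasiIso_mkHomFromSingle {K : CochainComplex (ModuleCat.{u} R) ℤ} [K.IsStrictlyGE 0]
    {A : ModuleCat.{u} R} (φ : A ⟶ K.X 0) (hφ : ∀ k, (ComplexShape.up ℤ).Rel 0 k → φ ≫ K.d 0 k = 0)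
    (hinj : Function.Injective φ) (hker : ∀ x, K.d 0 1 x = 0 → ∃ a, φ a = x)
    (hK : ∀ j, 0 < j → K.ExactAt j) : QuasiIso (HomologicalComplex.mkHomFromSingle φ hφ) := by
  rw [quasiIso_iff_elements]
  intro i j k hij hjk
  have hK' : ∀ j < 0, Subsingleton (K.X j) := fun j hj =>
    ModuleCat.subsingleton_of_isZero (K.isZero_of_isStrictlyGE 0 j hj)
  rcases lt_trichotomy j 0 with hj | rfl | hj
  · have := subsingleton_single_X A hj.ne
    have := hK' j hj
    exact ⟨fun x _ _ => ⟨0, Subsingleton.elim _ _⟩, fun z _ => ⟨0, 0, map_zero _,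
      Subsingleton.elim _ _⟩⟩
  · obtain rfl : k = 1 := by lia
    have := hK' i (by lia)
    have hf : ∀ x, (HomologicalComplex.mkHomFromSingle φ hφ).f 0 x =
        φ ((HomologicalComplex.singleObjXSelf (.up ℤ) 0 A).hom x) := fun x => by
      rw [HomologicalComplex.mkHomFromSingle_f]
      rfl
    constructor
    · rintro x - ⟨y, hy⟩
      rw [Subsingleton.elim y 0, map_zero, hf] at hy
      have h0 := hinj (hy.symm.trans (map_zero φ.hom).symm)
      refine ⟨0, ?_⟩
      have h1 := congr($((HomologicalComplex.singleObjXSelf (.up ℤ) 0 A).hom_inv_id).hom x)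
      rw [map_zero]
      refine Eq.trans ?_ h1
      exact (congr((HomologicalComplex.singleObjXSelf (.up ℤ) 0 A).inv $h0).trans (map_zero _)).symm
    · intro z hz
      obtain ⟨a, ha⟩ := hker z hz
      refine ⟨(HomologicalComplex.singleObjXSelf (.up ℤ) 0 A).inv a, 0, ?_, ?_⟩
      · rw [HomologicalComplex.single_obj_d]
        rfl
      · rw [hf, map_zero, add_zero, ← ha]
        exact congr(φ ($((HomologicalComplex.singleObjXSelf (.up ℤ) 0 A).inv_hom_id).hom a)).symm
  · have := subsingleton_single_X A hj.ne'
    refine ⟨fun x _ _ => ⟨0, Subsingleton.elim _ _⟩, fun z hz => ?_⟩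
    obtain ⟨y, hy⟩ := (exactAt_iff_forall_exists hij hjk).1 (hK j hj) z hz
    exact ⟨0, y, map_zero _, by rw [map_zero, zero_add]; exact hy.symm⟩

lemma CategoryTheory.InjectiveResolution.exists_linearMap_cochainComplex {A : ModuleCat.{u} R}
    (E : InjectiveResolution A) : ∃ ι : A →ₗ[R] E.cochainComplex.X 0, Function.Injective ι ∧
      ∀ x, E.cochainComplex.d 0 1 x = 0 ↔ ∃ a, ι a = x := by
  have : QuasiIso E.ι' := inferInstance
  obtain ⟨h1, h2⟩ := (quasiIso_iff_elements E.ι').1 this (-1) 0 1 (by simp) (by simp)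
  have := ModuleCat.subsingleton_of_isZero (E.cochainComplex.isZero_of_isStrictlyGE 0 (-1) (by lia))
  let e := HomologicalComplex.singleObjXSelf (.up ℤ) 0 A
  have hd : ∀ i j x, ((singleFunctor (ModuleCat.{u} R) 0).obj A).d i j x = 0 := fun i j x =>
    congr($(HomologicalComplex.single_obj_d (.up ℤ) 0 A i j).hom x)
  refine ⟨(e.inv ≫ E.ι'.f 0).hom, (injective_iff_map_eq_zero _).2 fun a ha => ?_, fun x =>
    ⟨fun hx => ?_, ?_⟩⟩
  · obtain ⟨w, hw⟩ := h1 (e.inv a) (hd _ _ _) ⟨0, (map_zero _).trans ha.symm⟩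
    have h3 := congr($(e.inv_hom_id).hom a)
    refine h3.symm.trans ?_
    exact congr(e.hom $(hw.symm.trans (hd _ _ _))).trans (map_zero _)
  · obtain ⟨w, y, -, hw⟩ := h2 x hx
    rw [Subsingleton.elim y 0, map_zero, add_zero] at hw
    exact ⟨e.hom w, congr(E.ι'.f 0 ($(e.hom_inv_id).hom w)).trans hw.symm⟩
  · rintro ⟨a, rfl⟩
    have h3 := congr($(E.ι'.comm 0 1).hom (e.inv a))
    exact h3.trans (congr(E.ι'.f 1 $(hd _ _ _)).trans (map_zero _))

variable (F : Type u) [AddCommGroup F] [Module R F]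

/-- A cocycle of Hom(F, E) in positive degree represents an Ext class; its vanishing provides a
primitive. -/
lemma homModuleComplex_exactAt_of_ext_eq_zero {A : ModuleCat.{u} R} (E : InjectiveResolution A)
    (hA : ∀ i : ℕ, 0 < i → Subsingleton (Abelian.Ext (ModuleCat.of R F) A i)) (j : ℤ) (hj : 0 < j) :
    (homModuleComplex F E.cochainComplex).ExactAt j := by
  obtain ⟨p, rfl⟩ : ∃ p : ℕ, j = (p + 1 : ℕ) := ⟨(j - 1).toNat, by lia⟩
  rw [exactAt_iff_forall_exists (i := (p : ℤ)) (k := (p + 2 : ℕ)) (by lia) (by lia)]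
  intro (x : F →ₗ[R] E.cochainComplex.X (p + 1 : ℕ)) hx
  let e (n : ℕ) := E.cochainComplexXIso n n rfl
  have hd (m n : ℕ) : E.cochainComplex.d m n = (e m).hom ≫ E.cocomplex.d m n ≫ (e n).inv :=
    E.cochainComplex_d m n m n rfl rfl
  have hx' : ModuleCat.ofHom x ≫ E.cochainComplex.d (p + 1 : ℕ) (p + 2 : ℕ) = 0 :=
    ModuleCat.hom_ext hx
  have := hA (p + 1) p.succ_pos
  obtain ⟨g, hg⟩ := (E.extMk_eq_zero_iff (ModuleCat.ofHom x ≫ (e (p + 1)).hom) (p + 2) rfl (by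
    rw [hd, ← Category.assoc, ← Category.assoc, Preadditive.IsIso.comp_right_eq_zero] at hx'
    exact hx') p rfl).1 (Subsingleton.elim _ _)
  refine ⟨(g ≫ (e p).inv).hom, ?_⟩
  have h : (g ≫ (e p).inv) ≫ E.cochainComplex.d p (p + 1 : ℕ) = ModuleCat.ofHom x := by
    rw [hd, Category.assoc, Iso.inv_hom_id_assoc, reassoc_of% hg, Iso.hom_inv_id, Category.comp_id]
  exact congr($(h).hom)

lemma injDimLE_single_of_injective (Q : ModuleCat.{u} R) [Injective Q] :
    InjDimLE ((HomologicalComplex.single (ModuleCat.{u} R) (.up ℤ) 0).obj Q) 0 := by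
  have h : ∀ i, Injective (((HomologicalComplex.single (ModuleCat.{u} R) (.up ℤ) 0).obj Q).X i) :=
    fun i => by
      by_cases hi : i = 0
      · subst hi
        exact Injective.of_iso (HomologicalComplex.singleObjXSelf (.up ℤ) 0 Q).symm inferInstance
      · exact (HomologicalComplex.isZero_single_obj_X _ _ _ _ hi).injective
  refine ⟨_, 𝟙 _, ⟨h, isKInjective_of_injective _ 0⟩, inferInstance, ?_⟩
  rw [isStrictlyLE_iff]
  exact fun i hi => HomologicalComplex.isZero_single_obj_X _ _ _ _ hi.ne'

/-- By left exactness and Ext vanishing, Hom(F, I) is quasi-isomorphic to the injective module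
Hom(F, M) in degree 0. So I has the lifting property above degree 0, which exhibits M as a direct
summand of I⁰. -/
theorem injective_of_injective_homModule [IsNoetherianRing R] [Module.FaithfullyFlat R F]
    (M : Type u) [AddCommGroup M] [Module R M]
    (hM : ∀ i : ℕ, 0 < i → Subsingleton (Abelian.Ext (ModuleCat.of R F) (ModuleCat.of R M) i))
    [Module.Injective R (F →ₗ[R] M)] : Module.Injective R M := by
  let E := injectiveResolution (ModuleCat.of R M)
  let I := E.cochainComplex
  have hI : ∀ i, Injective (I.X i) := inferInstance
  have hI' := fun i => (Module.injective_iff_injective_object R (I.X i)).2 (hI i)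
  have : I.IsKInjective := inferInstance
  obtain ⟨ι, hι, hker⟩ := E.exists_linearMap_cochainComplex
  have : (homModuleComplex F I).IsStrictlyGE 0 := by
    rw [isStrictlyGE_iff]
    intro i hi
    have := ModuleCat.subsingleton_of_isZero (I.isZero_of_isStrictlyGE 0 i hi)
    exact ModuleCat.isZero_of_subsingleton (ModuleCat.of R (F →ₗ[R] I.X i))
  have hd : (I.d 0 1).hom ∘ₗ ι = 0 := LinearMap.ext fun a => (hker _).2 ⟨a, rfl⟩
  let φ : ModuleCat.of R (F →ₗ[R] M) ⟶ (homModuleComplex F I).X 0 := ModuleCat.ofHom (ι.compRight R)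
  have hφ : ∀ k, (ComplexShape.up ℤ).Rel 0 k → φ ≫ (homModuleComplex F I).d 0 k = 0 := by
    rintro k rfl
    exact ModuleCat.hom_ext (LinearMap.ext fun x => LinearMap.ext fun a => congr($hd (x a)))
  have := quasiIso_mkHomFromSingle φ hφ
    (fun x y h => LinearMap.ext fun a => hι congr((show F →ₗ[R] I.X 0 from $h) a))
    (fun (x : F →ₗ[R] I.X 0) hx => by
      have hx' : ∀ a, x a ∈ LinearMap.range ι := fun a =>
        (hker _).1 congr((show F →ₗ[R] I.X 1 from $hx) a)
      refine ⟨(LinearEquiv.ofInjective ι hι).symm.toLinearMap ∘ₗ x.codRestrict _ hx',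
        LinearMap.ext fun a => ?_⟩
      exact congr_arg Subtype.val ((LinearEquiv.ofInjective ι hι).apply_symm_apply ⟨x a, hx' a⟩))
    (homModuleComplex_exactAt_of_ext_eq_zero F E hM)
  have : Injective (ModuleCat.of R (F →ₗ[R] M)) :=
    (Module.injective_iff_injective_object R _).1 inferInstance
  have := homModuleComplex_isKInjective F I
  have hL := LiftsAbove.of_tensorProduct F (I := I) (n := 0)
    (N := LinearMap.ker (I.d 1 2).hom) fun N _ _ =>
      (liftsAbove_of_injDimLE (HomologicalComplex.mkHomFromSingle φ hφ)
        (injDimLE_single_of_injective _) N).tensorProduct_of_homModuleComplex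
  -- The inclusion of ker d¹ lifts to a section s of I⁰ → ker d¹, so 1 - sδ projects I⁰ onto ker d⁰,
  -- the image of M.
  obtain ⟨s, hs⟩ := hL 0 le_rfl (LinearMap.ker (I.d 1 2).hom).subtype
    (LinearMap.ext fun x => x.2)
  let δ : I.X 0 →ₗ[R] LinearMap.ker (I.d 1 2).hom :=
    (I.d 0 1).hom.codRestrict _ fun x => d_apply_d_apply I 0 1 2 x
  let ρ : I.X 0 →ₗ[R] I.X 0 := LinearMap.id - s ∘ₗ δ
  have hρ : ∀ x, ρ x ∈ LinearMap.range ι := fun x => (hker _).1 (by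
    have h := congr($hs (δ x))
    exact (map_sub (I.d 0 1).hom x (s (δ x))).trans (sub_eq_zero.2 h.symm))
  have hM' : Injective (ModuleCat.of R M) := by
    refine Retract.injective (Y := I.X 0) ⟨ModuleCat.ofHom ι, ModuleCat.ofHom
      ((LinearEquiv.ofInjective ι hι).symm.toLinearMap ∘ₗ ρ.codRestrict (LinearMap.range ι) hρ), ?_⟩
    refine ModuleCat.hom_ext (LinearMap.ext fun a => ?_)
    have h : ρ.codRestrict (LinearMap.range ι) hρ (ι a) = LinearEquiv.ofInjective ι hι a := by
      refine Subtype.ext ?_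
      have h0 : δ (ι a) = 0 := Subtype.ext ((hker _).2 ⟨a, rfl⟩)
      change ι a - s (δ (ι a)) = ι a
      rw [h0, map_zero, sub_zero]
    exact ((LinearEquiv.ofInjective ι hι).symm_apply_eq).2 h
  exact (Module.injective_iff_injective_object R M).2 hM'

end HomInjective

theorem corollary3p1 (R : Type u) [CommRing R] [IsNoetherianRing R]
    (F : Type u) [AddCommGroup F] [Module R F] [Module.FaithfullyFlat R F] :
    (∀ M : CochainComplex (ModuleCat.{u} R) ℤ, injDim (rHom R F M) = injDim M) ∧
    (∀ M : CochainComplex (ModuleCat.{u} R) ℤ, M.Acyclic ↔ (rHom R F M).Acyclic) ∧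
    (∀ (M : Type u) [AddCommGroup M] [Module R M],
      (∀ i : ℕ, 0 < i →
        Subsingleton (Abelian.Ext (ModuleCat.of R F) (ModuleCat.of R M) i)) →
      (Module.Injective R (F →ₗ[R] M) ↔ Module.Injective R M)) := by
  refine ⟨injDim_rHom F, fun M => (acyclic_rHom_iff F M).symm, fun M _ _ hM => ⟨fun _ => ?_,
    fun _ => homModule_injective F M⟩⟩
  exact injective_of_injective_homModule F M hM
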